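/- **Theorem 2.** Let $G$ be a finite simple graph without isolated vertices. For $p,q\ge 0$ put $\hbar(p,q)=(p+q)\,h\!\left(\frac{p}{p+q}\right)$, where $h(x)=-x\log_2x-(1-x)\log_2(1-x)$ is the binary entropy, and $\hbar(p,q)=0$ if $p=0$ or $q=0$. A probability distribution $P$ on $V(G)$ is *$G$-balanced* if it maximizes $\min_{\{x,y\}\in E(G)}\hbar(P(x),P(y))$ among all probability distributions on $V(G)$. A vertex $x$ is *$P$-critical* if $P(x)<P(y)$ for every neighbour $y$ of $x$. For $X\subseteq V(G)$, let $\Gamma X$ be the set of vertices outside $X$ that have a neighbour in $X$. Let $\alpha$ denote the stability number (the maximum size of a set of pairwise non-adjacent vertices). A *perfect 2-matching* is an assignment of weights $0,\frac12,1$ to the edges such that at every vertex the weights of the incident edges sum to $1$. Let $P$ be a $G$-balanced distribution, $X$ the set of $P$-critical vertices, and $F=G-(X\cup\Gamma X)$. Then $$\alpha(G)=|X|+\alpha(F),$$ and $F$ has a perfect 2-matching. Moreover, the term $|X|$ is computable in polynomial time: there are a single algorithm (a program for a random access machine with unit-cost addition and truncated subtraction and without multiplication) and a polynomial $p$ such that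 for every $n$, every graph $G$ on $n$ vertices without isolated vertices (given by its adjacency matrix) and every $G$-balanced distribution $P$, the algorithm on input $G$ halts after at most $p(n)$ steps and outputs the number of $P$-critical vertices. -/

import Mathlib

namespace ConjunctiveCapacity

/-- Binary entropy, with logarithms to the base 2. -/
noncomputable def binEnt (x : ℝ) : ℝ :=
  -x * Real.logb 2 x - (1 - x) * Real.logb 2 (1 - x)

/-- `ℏ(p, q) = (p + q) h(p / (p + q))`. For `p = 0` or `q = 0` the value is `0`, which is the
continuous extension from positive `p`, `q`. -/
noncomputable def hbar (p q : ℝ) : ℝ :=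
  (p + q) * binEnt (p / (p + q))

/-- `l(G, P)`: the minimum of `ℏ(P x, P y)` over the edges `xy` of `G`. (On a finite graph with an
edge the set is finite and nonempty, so that this infimum is a minimum.) -/
noncomputable def edgeMin {V : Type*} (G : SimpleGraph V) (P : V → ℝ) : ℝ :=
  sInf {r : ℝ | ∃ x y, G.Adj x y ∧ r = hbar (P x) (P y)}

/-- A probability distribution on the vertices is `G`-balanced if it maximizes `l(G, ·)` among all
probability distributions on the vertices. -/
def IsBalanced {V : Type*} [Fintype V] (G : SimpleGraph V) (P : V → ℝ) : Prop :=
  P ∈ stdSimplex ℝ V ∧ ∀ Q ∈ stdSimplex ℝ V, edgeMin G Q ≤ edgeMin G P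

/-- `x` is `P`-critical if all its neighbours have strictly larger probability. -/
def IsCritical {V : Type*} (G : SimpleGraph V) (P : V → ℝ) (x : V) : Prop :=
  ∀ y, G.Adj x y → P x < P y

open Classical in
/-- The set of `P`-critical vertices. -/
noncomputable def criticalSet {V : Type*} [Fintype V] (G : SimpleGraph V) (P : V → ℝ) :
    Finset V :=
  Finset.univ.filter fun x => IsCritical G P x

open Classical in
/-- `ΓX`: the vertices outside `X` that are adjacent to some vertex of `X`. -/
noncomputable def nbr {V : Type*} [Fintype V] (G : SimpleGraph V) (X : Finset V) : Finset V :=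
  Finset.univ.filter fun y => y ∉ X ∧ ∃ x ∈ X, G.Adj x y

open Classical in
/-- The vertex set of `G - (X ∪ ΓX)`, where `X` is the set of `P`-critical vertices. -/
noncomputable def restSet {V : Type*} [Fintype V] (G : SimpleGraph V) (P : V → ℝ) : Finset V :=
  (criticalSet G P ∪ nbr G (criticalSet G P))ᶜ

/-- The graph `F = G - (X ∪ ΓX)`, where `X` is the set of `P`-critical vertices. -/
noncomputable abbrev restGraph {V : Type*} [Fintype V] (G : SimpleGraph V) (P : V → ℝ) :
    SimpleGraph (restSet G P : Set V) :=
  G.induce (restSet G P : Set V)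

/-- A perfect 2-matching: weights `0`, `1/2`, `1` on the edges (and `0` on pairs that are not
edges) such that the weights of the edges at each vertex add up to `1`. -/
structure IsPerfectTwoMatching {V : Type*} [Fintype V] (G : SimpleGraph V)
    (w : Sym2 V → ℝ) : Prop where
  values : ∀ e, w e = 0 ∨ w e = 1 / 2 ∨ w e = 1
  support : ∀ e, e ∉ G.edgeSet → w e = 0
  sum_eq_one : ∀ v, ∑ u, w s(v, u) = 1

/-- The graph has a perfect 2-matching. -/
def HasPerfectTwoMatching {V : Type*} [Fintype V] (G : SimpleGraph V) : Prop :=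
  ∃ w : Sym2 V → ℝ, IsPerfectTwoMatching G w

/-! A random access machine with addition and truncated subtraction (no multiplication) at unit
cost, programmed in a structured language. In `t` steps the bit lengths of its numbers grow by at
most `t` plus a constant depending on the program, so that polynomial time on it is polynomial time
in the usual sense. -/

/-- A state: registers, of which a program mentions finitely many, and an indirectly addressed
memory. -/
structure RamState where
  reg : ℕ → ℕ
  mem : ℕ → ℕ

/-- Programs of the machine. -/
inductive RamProg : Type
  /-- `reg d := c` -/
  | const (d c : ℕ) : RamProg
  /-- `reg d := reg i + reg j` -/
  | add (d i j : ℕ) : RamProg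
  /-- `reg d := reg i - reg j`, truncated at `0` -/
  | sub (d i j : ℕ) : RamProg
  /-- `reg d := mem[reg i]` -/
  | load (d i : ℕ) : RamProg
  /-- `mem[reg i] := reg j` -/
  | store (i j : ℕ) : RamProg
  /-- first `a`, then `b` -/
  | seq (a b : RamProg) : RamProg
  /-- if `reg i ≠ 0` then `a` else `b` -/
  | ite (i : ℕ) (a b : RamProg) : RamProg
  /-- while `reg i ≠ 0` do `a` -/
  | loop (i : ℕ) (a : RamProg) : RamProg

/-- `RamExec a s t s'`: the program `a`, started in state `s`, halts after exactly `t` steps in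
state `s'`. Every assignment and every test of a register is one step. -/
inductive RamExec : RamProg → RamState → ℕ → RamState → Prop
  | const (d c : ℕ) (s : RamState) :
      RamExec (.const d c) s 1 ⟨Function.update s.reg d c, s.mem⟩
  | add (d i j : ℕ) (s : RamState) :
      RamExec (.add d i j) s 1 ⟨Function.update s.reg d (s.reg i + s.reg j), s.mem⟩
  | sub (d i j : ℕ) (s : RamState) :
      RamExec (.sub d i j) s 1 ⟨Function.update s.reg d (s.reg i - s.reg j), s.mem⟩
  | load (d i : ℕ) (s : RamState) :
      RamExec (.load d i) s 1 ⟨Function.update s.reg d (s.mem (s.reg i)), s.mem⟩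
  | store (i j : ℕ) (s : RamState) :
      RamExec (.store i j) s 1 ⟨s.reg, Function.update s.mem (s.reg i) (s.reg j)⟩
  | seq {a b : RamProg} {s s' s'' : RamState} {t t' : ℕ}
      (h : RamExec a s t s') (h' : RamExec b s' t' s'') :
      RamExec (.seq a b) s (t + t') s''
  | ite_true {i : ℕ} {a b : RamProg} {s s' : RamState} {t : ℕ}
      (hi : s.reg i ≠ 0) (h : RamExec a s t s') :
      RamExec (.ite i a b) s (t + 1) s'
  | ite_false {i : ℕ} {a b : RamProg} {s s' : RamState} {t : ℕ}
      (hi : s.reg i = 0) (h : RamExec b s t s') :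
      RamExec (.ite i a b) s (t + 1) s'
  | loop_stop {i : ℕ} {a : RamProg} {s : RamState} (hi : s.reg i = 0) :
      RamExec (.loop i a) s 1 s
  | loop_step {i : ℕ} {a : RamProg} {s s' s'' : RamState} {t t' : ℕ}
      (hi : s.reg i ≠ 0) (h : RamExec a s t s') (h' : RamExec (.loop i a) s' t' s'') :
      RamExec (.loop i a) s (t + t' + 1) s''

open Classical in
/-- The input state for a graph on `{0, …, n - 1}`: register `0` holds `n`, memory cell `i * n + j`
holds the entry `(i, j)` of the adjacency matrix, and all the rest is `0`. -/
noncomputable def graphInput {n : ℕ} (G : SimpleGraph (Fin n)) : RamState where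
  reg := fun r => if r = 0 then n else 0
  mem := fun k => if ∃ i j : Fin n, k = i.val * n + j.val ∧ G.Adj i j then 1 else 0

/-- On input `G`, the program `a` halts within `T` steps with the number `m` in register `0`. -/
def RamOutputs {n : ℕ} (a : RamProg) (G : SimpleGraph (Fin n)) (T m : ℕ) : Prop :=
  ∃ (t : ℕ) (s : RamState), RamExec a (graphInput G) t s ∧ t ≤ T ∧ s.reg 0 = m

end ConjunctiveCapacity

/-! ### The function `hbar`: derivative and monotonicity. -/

namespace ConjunctiveCapacity

open Filter Topology

/-! Write `l` for the edge minimum of the balanced distribution `P`, and call an edge tight if it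
attains `l`. The derivative of `ℏ(p, q)` in `p` is `log₂((p + q) / p)`, so the smaller argument has
the larger derivative. Optimality of `P` means that no direction of nonpositive total mass increases
`ℏ` on all tight edges (`IsBalanced.sum_pos_of_direction`). Taking mass from a set `O` and giving it
to its tight neighbours therefore yields Hall's condition for `O`, provided tight edges from `O`
never lead to larger masses. If they always lead to strictly smaller ones and `O` is nonempty, the
inequality is strict.

As `ℏ(p, p) = 2p` and `ℏ` increases in each argument, the level `l / 2` sorts the vertices: below it
lies the critical set `X`, above it `Y = ΓX`, and on it `F`. Together with the Hall inequalities
this is a fractional Gallai–Edmonds decomposition (`IsDecomp`), and everything else uses only that.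
The surplus of `Y` in `X` lets a stable set trade its part in `Y` for vertices of `X`, which gives
the formula for `α`; Hall's condition inside `F` gives a permutation of `F` along edges, hence a
perfect 2-matching.

The algorithm never sees `P`. It runs an auction on the bipartite double cover: each vertex is a
bidder that wants one of its neighbours, bids on a cheapest one and raises its price by 1.
Pigeonhole finds an unused price in any interval of `n` prices missed by some object, and slack 1
cannot cross such a gap. Comparing bidders and objects above or below the gap with the Hall
inequalities shows that prices outside `Y` never exceed `n + 1` (`AuctionInv.bid_le`), while prices
on `Y` finally do (`AuctionInv.lt_of_settled`). So `X` consists of the bidders that see only prices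
above `n + 1`. Each sweep before the end raises the sum of the prices, which is at most `(2n + 2)n`;
this bounds the time. -/

theorem hbar_eq_log {p q : ℝ} (hp : 0 < p) (hq : 0 < q) :
    hbar p q =
      ((p + q) * Real.log (p + q) - p * Real.log p - q * Real.log q) / Real.log 2 := by
  have h : 0 < p + q := by positivity
  have h1 : 1 - p / (p + q) = q / (p + q) := by field_simp; ring
  have h2 : Real.log 2 ≠ 0 := (Real.log_pos one_lt_two).ne'
  rw [hbar, binEnt, h1, Real.logb, Real.logb, Real.log_div hp.ne' h.ne', Real.log_div hq.ne' h.ne']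
  field_simp
  ring

theorem hbar_zero_left (q : ℝ) : hbar 0 q = 0 := by simp [hbar, binEnt]

theorem hbar_comm {p q : ℝ} (hp : 0 < p) (hq : 0 < q) : hbar p q = hbar q p := by
  rw [hbar_eq_log hp hq, hbar_eq_log hq hp, add_comm q p]; ring

theorem hbar_self {p : ℝ} (hp : 0 < p) : hbar p p = 2 * p := by
  have h2 : Real.log 2 ≠ 0 := (Real.log_pos one_lt_two).ne'
  rw [hbar_eq_log hp hp, ← two_mul, Real.log_mul two_ne_zero hp.ne']
  field_simp; ring

theorem hbar_mul (p q : ℝ) {r : ℝ} (hr : 0 < r) :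
    hbar (r * p) (r * q) = r * hbar p q := by
  rw [hbar, hbar, ← mul_add, mul_div_mul_left _ _ hr.ne', mul_assoc]

/-- The directional derivative of `ℏ`. -/
theorem hasDerivAt_hbar {p q : ℝ} (hp : 0 < p) (hq : 0 < q) (a b : ℝ) :
    HasDerivAt (fun t => hbar (p + t * a) (q + t * b))
      ((a * Real.log ((p + q) / p) + b * Real.log ((p + q) / q)) / Real.log 2) 0 := by
  have line (x c : ℝ) : HasDerivAt (fun t : ℝ => x + t * c) c 0 := by
    simpa using ((hasDerivAt_id (0 : ℝ)).mul_const c).const_add x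
  have key (x c : ℝ) (hx : 0 < x) : HasDerivAt (fun t : ℝ => (x + t * c) * Real.log (x + t * c))
      (c * Real.log x + c) 0 := by
    have h := (line x c).mul ((line x c).log (by simpa using hx.ne'))
    exact h.congr_deriv (by rw [zero_mul, add_zero, mul_div_cancel₀ _ hx.ne'])
  have pos (x c : ℝ) (hx : 0 < x) : ∀ᶠ t in 𝓝 (0 : ℝ), 0 < x + t * c :=
    (line x c).continuousAt.eventually (lt_mem_nhds (by simpa using hx))
  have h := (((key (p + q) (a + b) (by positivity)).sub (key p a hp)).sub (key q b hq)).div_const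
    (Real.log 2)
  refine (h.congr_of_eventuallyEq ?_).congr_deriv ?_
  · filter_upwards [pos p a hp, pos q b hq] with t h1 h2
    rw [hbar_eq_log h1 h2]
    simp only [Pi.sub_apply]
    rw [show p + t * a + (q + t * b) = p + q + t * (a + b) by ring]
  · rw [Real.log_div (by positivity) hp.ne', Real.log_div (by positivity) hq.ne']
    ring

theorem log_ratio_pos {p q : ℝ} (hp : 0 < p) (hq : 0 < q) : 0 < Real.log ((p + q) / p) :=
  Real.log_pos (by rw [lt_div_iff₀ hp]; linarith)

theorem strictMonoOn_hbar {q : ℝ} (hq : 0 < q) :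
    StrictMonoOn (fun p => hbar p q) (Set.Ioi 0) := by
  have hd (p : ℝ) (hp : 0 < p) : HasDerivAt (fun p => hbar p q)
      (Real.log ((p + q) / p) / Real.log 2) p := by
    have h := hasDerivAt_hbar hp hq 1 0
    have h' := HasDerivAt.comp p (h₂ := fun t => hbar (p + t * 1) (q + t * 0))
      (h := fun x => x - p) (by simpa using h) ((hasDerivAt_id p).sub_const p)
    simpa [Function.comp_def] using h'
  refine strictMonoOn_of_deriv_pos (convex_Ioi 0)
    (fun p hp => (hd p hp).continuousAt.continuousWithinAt) fun p hp => ?_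
  rw [interior_Ioi] at hp
  rw [(hd p hp).deriv]
  exact div_pos (log_ratio_pos hp hq) (Real.log_pos one_lt_two)

theorem hbar_lt_hbar {p q p' q' : ℝ} (hp : 0 < p) (hq : 0 < q) (h : p < p') (h' : q ≤ q') :
    hbar p q < hbar p' q' := by
  have hp' := hp.trans h
  have hq' := hq.trans_le h'
  calc hbar p q < hbar p' q := strictMonoOn_hbar hq hp hp' h
    _ = hbar q p' := hbar_comm hp' hq
    _ ≤ hbar q' p' := (strictMonoOn_hbar hp').monotoneOn hq hq' h'
    _ = hbar p' q' := hbar_comm hq' hp'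

/-! ### First-order optimality and Hall inequalities for tight edges. -/

variable {V : Type*} [Fintype V] {G : SimpleGraph V} {P : V → ℝ}

theorem finite_edgeValues (G : SimpleGraph V) (P : V → ℝ) :
    {r : ℝ | ∃ x y, G.Adj x y ∧ r = hbar (P x) (P y)}.Finite := by
  refine (Set.finite_range fun e : V × V => hbar (P e.1) (P e.2)).subset ?_
  rintro r ⟨x, y, -, rfl⟩
  exact ⟨(x, y), rfl⟩

theorem edgeMin_le {x y : V} (h : G.Adj x y) : edgeMin G P ≤ hbar (P x) (P y) :=
  csInf_le (finite_edgeValues G P).bddBelow ⟨x, y, h, rfl⟩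

theorem lt_edgeMin [Nonempty V] (hG : ∀ v, ∃ w, G.Adj v w) {r : ℝ}
    (h : ∀ x y, G.Adj x y → r < hbar (P x) (P y)) : r < edgeMin G P := by
  obtain ⟨v⟩ := ‹Nonempty V›
  obtain ⟨w, hw⟩ := hG v
  have hne : {r : ℝ | ∃ x y, G.Adj x y ∧ r = hbar (P x) (P y)}.Nonempty := ⟨_, v, w, hw, rfl⟩
  obtain ⟨x, y, hxy, e⟩ := hne.csInf_mem (finite_edgeValues G P)
  rw [edgeMin, e]
  exact h x y hxy

theorem IsBalanced.nonempty (hP : IsBalanced G P) : Nonempty V := by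
  by_contra h
  rw [not_nonempty_iff] at h
  simpa using hP.1.2

/-- The uniform distribution competes with `P`, and its value is positive. -/
theorem IsBalanced.edgeMin_pos (hG : ∀ v, ∃ w, G.Adj v w) (hP : IsBalanced G P) :
    0 < edgeMin G P := by
  have := hP.nonempty
  have hc : (0 : ℝ) < Fintype.card V := by exact_mod_cast Fintype.card_pos
  refine (lt_edgeMin hG fun x y _ => ?_).trans_le (hP.2 (fun _ => (Fintype.card V : ℝ)⁻¹) ⟨?_, ?_⟩)
  · rw [hbar_self (by positivity)]; positivity
  · intro; positivity
  · simp [hc.ne']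

theorem IsBalanced.pos (hG : ∀ v, ∃ w, G.Adj v w) (hP : IsBalanced G P) (v : V) : 0 < P v := by
  refine (hP.1.1 v).lt_of_ne fun h => ?_
  obtain ⟨w, hw⟩ := hG v
  have h1 := edgeMin_le (P := P) hw
  rw [← h, hbar_zero_left] at h1
  exact h1.not_gt (hP.edgeMin_pos hG)

/-- The edges on which the minimum is attained. -/
def IsTight (G : SimpleGraph V) (P : V → ℝ) (u v : V) : Prop :=
  G.Adj u v ∧ hbar (P u) (P v) = edgeMin G P

/-- A direction in which `ℏ` increases on all tight edges has positive total mass. -/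
theorem IsBalanced.sum_pos_of_direction (hG : ∀ v, ∃ w, G.Adj v w) (hP : IsBalanced G P)
    (d : V → ℝ) (hd : ∀ u v, IsTight G P u v →
      0 < d u * Real.log ((P u + P v) / P u) + d v * Real.log ((P u + P v) / P v)) :
    0 < ∑ v, d v := by
  have hV := hP.nonempty
  have pos := hP.pos hG
  by_contra! hs
  have h1 : ∀ᶠ t in 𝓝[>] (0 : ℝ), ∀ u, 0 < P u + t * d u := by
    refine eventually_all.2 fun u => Filter.Eventually.filter_mono nhdsWithin_le_nhds ?_
    have : ContinuousAt (fun t : ℝ => P u + t * d u) 0 := by fun_prop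
    exact this.eventually (lt_mem_nhds (by simpa using pos u))
  have h2 : ∀ᶠ t in 𝓝[>] (0 : ℝ), ∀ u v, G.Adj u v →
      edgeMin G P < hbar (P u + t * d u) (P v + t * d v) := by
    refine eventually_all.2 fun u => eventually_all.2 fun v => ?_
    by_cases huv : G.Adj u v
    swap
    · simp [huv]
    have hder := hasDerivAt_hbar (pos u) (pos v) (d u) (d v)
    rcases (edgeMin_le (P := P) huv).lt_or_eq with hlt | heq
    · have := hder.continuousAt.eventually (lt_mem_nhds (a := edgeMin G P) (by simpa using hlt))
      exact (this.filter_mono nhdsWithin_le_nhds).mono fun t ht _ => ht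
    · have hpos := div_pos (hd u v ⟨huv, heq.symm⟩) (Real.log_pos one_lt_two)
      have hsl := (hasDerivAt_iff_tendsto_slope.1 hder).eventually (lt_mem_nhds hpos)
      have hsl' := hsl.filter_mono (nhdsWithin_mono (0 : ℝ) (fun t (ht : 0 < t) => ht.ne'))
      filter_upwards [hsl', self_mem_nhdsWithin] with t ht ht0 _
      rw [slope_def_field, sub_zero] at ht
      have := (div_pos_iff_of_pos_right ht0).1 ht
      simp only [zero_mul, add_zero] at this
      linarith
  obtain ⟨t, ⟨ht1, ht2⟩, ht0⟩ := ((h1.and h2).and self_mem_nhdsWithin).exists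
  have ht0 : 0 < t := ht0
  -- The perturbed weights have total at most 1, so by homogeneity normalizing them cannot lower any
  -- edge value.
  set S := ∑ u, (P u + t * d u) with hS
  have hSpos : 0 < S := Finset.sum_pos (fun u _ => ht1 u) Finset.univ_nonempty
  have hS1 : S ≤ 1 := by
    rw [hS, Finset.sum_add_distrib, ← Finset.mul_sum, hP.1.2]
    nlinarith
  have hQ : (fun u => S⁻¹ * (P u + t * d u)) ∈ stdSimplex ℝ V :=
    ⟨fun u => (mul_pos (inv_pos.2 hSpos) (ht1 u)).le, by
      rw [← Finset.mul_sum, ← hS, inv_mul_cancel₀ hSpos.ne']⟩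
  refine (hP.2 _ hQ).not_gt (lt_edgeMin hG fun x y hxy => ?_)
  rw [hbar_mul _ _ (inv_pos.2 hSpos)]
  have h3 := ht2 x y hxy
  have h4 : 1 ≤ S⁻¹ := (one_le_inv₀ hSpos).2 hS1
  have h5 := hP.edgeMin_pos hG
  nlinarith

open Classical in
/-- The vertices joined to `O` by a tight edge. -/
noncomputable def tightNbr (G : SimpleGraph V) (P : V → ℝ) (O : Finset V) : Finset V :=
  Finset.univ.filter fun v => ∃ u ∈ O, IsTight G P u v

/-- Take mass `κ` from each vertex of `O` and give mass 1 to each tight neighbour: by `hO` no tight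
edge loses to first order. An extra `η > 0` everywhere makes the gain strict, so the total mass of
the direction is positive; then `η` tends to 0. -/
theorem IsBalanced.mul_card_le_card_tightNbr (hG : ∀ v, ∃ w, G.Adj v w) (hP : IsBalanced G P)
    (O : Finset V) {κ : ℝ} (hκ : 1 ≤ κ)
    (hO : ∀ u ∈ O, ∀ v, IsTight G P u v →
      κ * Real.log ((P u + P v) / P u) ≤ Real.log ((P u + P v) / P v)) :
    κ * O.card ≤ (tightNbr G P O).card := by
  classical
  have pos := hP.pos hG
  have symm {u v : V} (h : IsTight G P u v) : IsTight G P v u :=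
    ⟨h.1.symm, by rw [hbar_comm (pos v) (pos u)]; exact h.2⟩
  set T := tightNbr G P O with hT
  have memT {u v : V} (hu : u ∈ O) (h : IsTight G P u v) : v ∈ T := by
    simp only [hT, tightNbr, Finset.mem_filter, Finset.mem_univ, true_and]
    exact ⟨u, hu, h⟩
  have key (η : ℝ) (hη : 0 < η) :
      0 < η * Fintype.card V + T.card - κ * O.card := by
    have := hP.sum_pos_of_direction hG
      (fun v => η + (if v ∈ T then 1 else 0) - κ * (if v ∈ O then 1 else 0)) ?_
    · simpa [Finset.sum_sub_distrib, Finset.sum_add_distrib, ← Finset.mul_sum, mul_comm] using this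
    intro u v huv
    have g1 := log_ratio_pos (pos u) (pos v)
    have g2 : 0 < Real.log ((P u + P v) / P v) := by
      rw [add_comm]; exact log_ratio_pos (pos v) (pos u)
    have c1 (hu : u ∈ O) := hO u hu v huv
    have c2 (hv : v ∈ O) := hO v hv u (symm huv)
    rw [add_comm (P v)] at c2
    have d1 (hu : u ∈ O) : v ∈ T := memT hu huv
    have d2 (hv : v ∈ O) : u ∈ T := memT hv (symm huv)
    generalize Real.log ((P u + P v) / P u) = x at *
    generalize Real.log ((P u + P v) / P v) = y at *
    by_cases hu : u ∈ O <;> by_cases hv : v ∈ O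
    -- With both ends in `O`, the two logarithms are equal, which forces `κ = 1`; the gain comes
    -- from `η` alone.
    · have := c1 hu
      have := c2 hv
      have hx : x ≤ y := by nlinarith
      have hy : y ≤ x := by nlinarith
      simp only [hu, hv, d1 hu, d2 hv, if_true]
      nlinarith
    · have := c1 hu
      simp only [hu, hv, d1 hu, if_true, if_false]
      split_ifs <;> nlinarith
    · have := c2 hv
      simp only [hu, hv, d2 hv, if_true, if_false]
      split_ifs <;> nlinarith
    · simp only [hu, hv, if_false]
      split_ifs <;> nlinarith
  have hlim : Tendsto (fun η : ℝ => η * Fintype.card V + T.card - κ * O.card) (𝓝[>] 0)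
      (𝓝 (0 * Fintype.card V + T.card - κ * O.card)) :=
    Tendsto.mono_left (Continuous.tendsto (by fun_prop) 0) nhdsWithin_le_nhds
  have := ge_of_tendsto hlim (eventually_mem_nhdsWithin.mono fun η hη => (key η hη).le)
  linarith

theorem IsBalanced.exists_tight (hG : ∀ v, ∃ w, G.Adj v w) (hP : IsBalanced G P) (u : V) :
    ∃ v, IsTight G P u v := by
  by_contra! h
  have := hP.mul_card_le_card_tightNbr hG {u} le_rfl (by simp [h])
  norm_num [tightNbr, h] at this

theorem log_ratio_le {p q : ℝ} (hp : 0 < p) (h : p ≤ q) :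
    Real.log ((q + p) / q) ≤ Real.log ((q + p) / p) := by
  have := hp.trans_le h
  gcongr

theorem IsBalanced.card_le_card_tightNbr (hG : ∀ v, ∃ w, G.Adj v w) (hP : IsBalanced G P)
    (O : Finset V) (hO : ∀ u ∈ O, ∀ v, IsTight G P u v → P v ≤ P u) :
    O.card ≤ (tightNbr G P O).card := by
  have := hP.mul_card_le_card_tightNbr hG O le_rfl fun u hu v huv => by
    rw [one_mul]; exact log_ratio_le (hP.pos hG v) (hO u hu v huv)
  rw [one_mul] at this
  exact_mod_cast this

/-- Finitely many pairs of vertices leave room for one `κ > 1` in all the strict inequalities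
between logarithms. -/
theorem IsBalanced.card_lt_card_tightNbr (hG : ∀ v, ∃ w, G.Adj v w) (hP : IsBalanced G P)
    (O : Finset V) (hne : O.Nonempty) (hO : ∀ u ∈ O, ∀ v, IsTight G P u v → P v < P u) :
    O.card < (tightNbr G P O).card := by
  have pos := hP.pos hG
  have h : ∀ᶠ κ in 𝓝[>] (1 : ℝ), ∀ u v, P v < P u →
      κ * Real.log ((P u + P v) / P u) ≤ Real.log ((P u + P v) / P v) := by
    refine eventually_all.2 fun u => eventually_all.2 fun v => ?_
    by_cases huv : P v < P u
    swap
    · simp [huv]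
    have hlt : 1 * Real.log ((P u + P v) / P u) < Real.log ((P u + P v) / P v) := by
      have := pos u
      have := pos v
      rw [one_mul]
      gcongr
    have hc : ContinuousAt (fun κ : ℝ => κ * Real.log ((P u + P v) / P u)) 1 := by fun_prop
    exact ((hc.eventually (gt_mem_nhds hlt)).filter_mono nhdsWithin_le_nhds).mono
      fun κ hκ _ => hκ.le
  obtain ⟨κ, hκ, hκ1⟩ := (h.and self_mem_nhdsWithin).exists
  have hκ1 : 1 < κ := hκ1
  have h1 := hP.mul_card_le_card_tightNbr hG O hκ1.le fun u hu v huv => hκ u v (hO u hu v huv)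
  have h2 : (0 : ℝ) < O.card := by exact_mod_cast hne.card_pos
  have h3 : (O.card : ℝ) < (tightNbr G P O).card := by nlinarith
  exact_mod_cast h3

/-! ### The decomposition by the level `l(G, P) / 2`. -/

/-- On an edge, a value below `l(G, P) / 2` forces the other one above. -/
theorem IsBalanced.lt_of_adj (hG : ∀ v, ∃ w, G.Adj v w) (hP : IsBalanced G P) {u v : V}
    (huv : G.Adj u v) (hu : P u < edgeMin G P / 2) : edgeMin G P / 2 < P v := by
  by_contra! h
  have h1 := hbar_lt_hbar (hP.pos hG u) (hP.pos hG v) hu h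
  rw [hbar_self (half_pos (hP.edgeMin_pos hG))] at h1
  have := edgeMin_le (P := P) huv
  linarith

/-- On a tight edge, a value above `l(G, P) / 2` forces the other one below. -/
theorem IsBalanced.lt_of_tight (hG : ∀ v, ∃ w, G.Adj v w) (hP : IsBalanced G P) {u v : V}
    (huv : IsTight G P u v) (hu : edgeMin G P / 2 < P u) : P v < edgeMin G P / 2 := by
  by_contra! h
  have h0 := half_pos (hP.edgeMin_pos hG)
  have h1 := hbar_lt_hbar h0 h0 hu h
  rw [hbar_self h0, huv.2] at h1
  linarith

theorem IsBalanced.eq_of_tight (hG : ∀ v, ∃ w, G.Adj v w) (hP : IsBalanced G P) {u v : V}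
    (huv : IsTight G P u v) (hu : P u = edgeMin G P / 2) : P v = edgeMin G P / 2 := by
  have huv' : IsTight G P v u :=
    ⟨huv.1.symm, by rw [hbar_comm (hP.pos hG v) (hP.pos hG u)]; exact huv.2⟩
  rcases lt_trichotomy (P v) (edgeMin G P / 2) with h | h | h
  · exact absurd hu (hP.lt_of_adj hG huv.1.symm h).ne'
  · exact h
  · exact absurd hu (hP.lt_of_tight hG huv' h).ne

/-- Every vertex has a tight edge, and from a vertex at or above the level this edge leads to no
larger mass, so that such a vertex is not critical. -/
theorem IsBalanced.mem_criticalSet (hG : ∀ v, ∃ w, G.Adj v w) (hP : IsBalanced G P) {u : V} :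
    u ∈ criticalSet G P ↔ P u < edgeMin G P / 2 := by
  simp only [criticalSet, Finset.mem_filter, Finset.mem_univ, true_and]
  refine ⟨fun h => ?_, fun h v huv => h.trans (hP.lt_of_adj hG huv h)⟩
  obtain ⟨v, huv⟩ := hP.exists_tight hG u
  have h1 := h v huv.1
  by_contra! h2
  have := hP.lt_of_adj hG huv.1
  rcases h2.lt_or_eq with h3 | h3
  · have := hP.lt_of_tight hG huv h3
    linarith
  · have := hP.eq_of_tight hG huv h3.symm
    linarith

theorem IsBalanced.mem_nbr (hG : ∀ v, ∃ w, G.Adj v w) (hP : IsBalanced G P) {u : V} :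
    u ∈ nbr G (criticalSet G P) ↔ edgeMin G P / 2 < P u := by
  simp only [nbr, Finset.mem_filter, Finset.mem_univ, true_and, hP.mem_criticalSet hG]
  refine ⟨fun ⟨_, x, hx, hxu⟩ => hP.lt_of_adj hG hxu hx, fun h => ⟨h.not_gt, ?_⟩⟩
  obtain ⟨v, huv⟩ := hP.exists_tight hG u
  exact ⟨v, hP.lt_of_tight hG huv h, huv.1.symm⟩

/-- A fractional Gallai–Edmonds decomposition: `X` is stable with all neighbours in `Y`, every
nonempty subset of `Y` has a surplus of neighbours in `X`, and the rest satisfies Hall's condition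
inside itself. -/
structure IsDecomp (G : SimpleGraph V) (X Y : Finset V) : Prop where
  disj : Disjoint X Y
  adj : ∀ x ∈ X, ∀ y, G.Adj x y → y ∈ Y
  surplus : ∀ O ⊆ Y, O.Nonempty → ∃ T ⊆ X, (∀ v ∈ T, ∃ u ∈ O, G.Adj u v) ∧ O.card < T.card
  hall : ∀ O, Disjoint O X → ∃ T, Disjoint T Y ∧ (∀ v ∈ T, ∃ u ∈ O, G.Adj u v) ∧ O.card ≤ T.card
  hall_rest : ∀ O, Disjoint O X → Disjoint O Y →
    ∃ T, Disjoint T X ∧ Disjoint T Y ∧ (∀ v ∈ T, ∃ u ∈ O, G.Adj u v) ∧ O.card ≤ T.card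

theorem IsBalanced.isDecomp (hG : ∀ v, ∃ w, G.Adj v w) (hP : IsBalanced G P) :
    IsDecomp G (criticalSet G P) (nbr G (criticalSet G P)) := by
  have hadj (O : Finset V) (v : V) (hv : v ∈ tightNbr G P O) : ∃ u ∈ O, G.Adj u v := by
    simp only [tightNbr, Finset.mem_filter, Finset.mem_univ, true_and] at hv
    exact hv.imp fun u hu => ⟨hu.1, hu.2.1⟩
  have ht (O : Finset V) (v : V) (hv : v ∈ tightNbr G P O) : ∃ u ∈ O, IsTight G P u v := by
    simpa [tightNbr] using hv
  refine ⟨?_, ?_, fun O hO hne => ⟨tightNbr G P O, ?_, hadj O, ?_⟩,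
    fun O hO => ⟨tightNbr G P O, ?_, hadj O, ?_⟩,
    fun O hO hO' => ⟨tightNbr G P O, ?_, ?_, hadj O, ?_⟩⟩
  · rw [Finset.disjoint_left]
    intro u
    rw [hP.mem_criticalSet hG, hP.mem_nbr hG, not_lt]
    exact le_of_lt
  · intro x hx y hxy
    rw [hP.mem_criticalSet hG] at hx
    exact (hP.mem_nbr hG).2 (hP.lt_of_adj hG hxy hx)
  · intro v hv
    obtain ⟨u, hu, huv⟩ := ht O v hv
    exact (hP.mem_criticalSet hG).2 (hP.lt_of_tight hG huv ((hP.mem_nbr hG).1 (hO hu)))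
  · refine hP.card_lt_card_tightNbr hG O hne fun u hu v huv => ?_
    have h := (hP.mem_nbr hG).1 (hO hu)
    exact (hP.lt_of_tight hG huv h).trans h
  all_goals simp only [Finset.disjoint_left, hP.mem_nbr hG, hP.mem_criticalSet hG, not_lt] at *
  · intro v hv
    obtain ⟨u, hu, huv⟩ := ht O v hv
    rcases (hO hu).lt_or_eq with h | h
    · exact (hP.lt_of_tight hG huv h).le
    · exact (hP.eq_of_tight hG huv h.symm).le
  · refine hP.card_le_card_tightNbr hG O fun u hu v huv => ?_
    rcases (hO hu).lt_or_eq with h | h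
    · exact ((hP.lt_of_tight hG huv h).trans h).le
    · rw [hP.eq_of_tight hG huv h.symm, h]
  · intro v hv
    obtain ⟨u, hu, huv⟩ := ht O v hv
    exact (hP.eq_of_tight hG huv (le_antisymm (hO' hu) (hO hu))).ge
  · intro v hv
    obtain ⟨u, hu, huv⟩ := ht O v hv
    exact (hP.eq_of_tight hG huv (le_antisymm (hO' hu) (hO hu))).le
  · refine hP.card_le_card_tightNbr hG O fun u hu v huv => ?_
    rw [hP.eq_of_tight hG huv (le_antisymm (hO' hu) (hO hu))]
    exact hO hu

end ConjunctiveCapacity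
-- Stability number and perfect 2-matching from a decomposition.
namespace ConjunctiveCapacity

variable {V : Type*} [Fintype V] {G : SimpleGraph V} {X Y : Finset V}

theorem IsDecomp.indepNum_eq [DecidableEq V] (h : IsDecomp G X Y) :
    G.indepNum = X.card + (G.induce ((X ∪ Y)ᶜ : Finset V)).indepNum := by
  apply le_antisymm
  · obtain ⟨S, hS⟩ := G.exists_isNIndepSet_indepNum
    rw [← hS.card_eq]
    have hS := hS.isIndepSet
    have h1 : (S ∩ (X ∪ Y)).card ≤ X.card := by
      rw [Finset.inter_union_distrib_left]
      rcases (S ∩ Y).eq_empty_or_nonempty with h0 | h0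
      · rw [h0, Finset.union_empty]
        exact Finset.card_le_card Finset.inter_subset_right
      -- Replace `S ∩ Y` by the larger set `T` of its neighbours in `X`, which `S` avoids because it
      -- is stable.
      · obtain ⟨T, hTX, hT, hc⟩ := h.surplus (S ∩ Y) Finset.inter_subset_right h0
        have hd : Disjoint (S ∩ X) T := by
          rw [Finset.disjoint_left]
          intro v hv hvT
          obtain ⟨u, hu, huv⟩ := hT v hvT
          exact hS (Finset.mem_inter.1 hu).1 (Finset.mem_inter.1 hv).1 huv.ne huv
        have h2 : ((S ∩ X) ∪ T).card ≤ X.card :=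
          Finset.card_le_card (Finset.union_subset Finset.inter_subset_right hTX)
        rw [Finset.card_union_of_disjoint hd] at h2
        have := Finset.card_union_le (S ∩ X) (S ∩ Y)
        omega
    have h2 : (S \ (X ∪ Y)).card ≤ (G.induce ((X ∪ Y)ᶜ : Finset V)).indepNum := by
      have h3 : (G.induce (((X ∪ Y)ᶜ : Finset V) : Set V)).IsIndepSet
          ((S.subtype (· ∈ (((X ∪ Y)ᶜ : Finset V) : Set V)) : Finset _) : Set _) := by
        intro a ha b hb hab hadj
        have ha := Finset.mem_subtype.1 ha
        have hb := Finset.mem_subtype.1 hb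
        exact hS ha hb (fun e => hab (Subtype.ext e)) hadj
      refine le_trans (le_of_eq ?_) h3.card_le_indepNum
      rw [Finset.card_subtype]
      congr 1
      ext v
      simp
    have := Finset.card_inter_add_card_sdiff S (X ∪ Y)
    omega
  · obtain ⟨S, hS⟩ := (G.induce (((X ∪ Y)ᶜ : Finset V) : Set V)).exists_isNIndepSet_indepNum
    rw [← hS.card_eq]
    have hS := hS.isIndepSet
    have memS {v : V} (hv : v ∈ S.map (Function.Embedding.subtype _)) : v ∉ X ∧ v ∉ Y := by
      obtain ⟨w, -, rfl⟩ := Finset.mem_map.1 hv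
      have := w.2
      simpa using this
    have hd : Disjoint X (S.map (Function.Embedding.subtype _)) := by
      rw [Finset.disjoint_right]
      exact fun v hv => (memS hv).1
    have hI : G.IsIndepSet ((X ∪ S.map (Function.Embedding.subtype _) : Finset V) : Set V) := by
      intro a ha b hb hab hadj
      have hX (x : V) (hx : x ∈ X) (z : V) (hz : G.Adj x z)
          (hz' : z ∈ X ∪ S.map (Function.Embedding.subtype _)) : False := by
        have hY := h.adj x hx z hz
        rcases Finset.mem_union.1 hz' with h1 | h1
        · exact Finset.disjoint_left.1 h.disj h1 hY
        · exact (memS h1).2 hY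
      rcases Finset.mem_union.1 ha with ha' | ha'
      · exact hX a ha' b hadj hb
      rcases Finset.mem_union.1 hb with hb' | hb'
      · exact hX b hb' a hadj.symm ha
      obtain ⟨a, haS, rfl⟩ := Finset.mem_map.1 ha'
      obtain ⟨b, hbS, rfl⟩ := Finset.mem_map.1 hb'
      exact hS haS hbS (fun e => hab (congrArg _ e)) hadj
    have := hI.card_le_indepNum
    rwa [Finset.card_union_of_disjoint hd, Finset.card_map] at this

/-- Each vertex puts weight 1/2 on the edge to its image; a vertex receives one half from its image
and one from its preimage. The two halves add up to 1 on the edge of a 2-cycle. -/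
theorem hasPerfectTwoMatching_of_perm {W : Type*} [Fintype W] {H : SimpleGraph W}
    (σ : Equiv.Perm W) (hσ : ∀ v, H.Adj v (σ v)) : HasPerfectTwoMatching H := by
  classical
  refine ⟨Sym2.lift ⟨fun u v => (1 / 2 : ℝ) * (if σ u = v then 1 else 0) +
    (1 / 2) * (if σ v = u then 1 else 0), fun u v => add_comm _ _⟩, ?_, ?_, ?_⟩
  · intro e
    induction e with | _ u v
    simp only [Sym2.lift_mk]
    split_ifs <;> norm_num
  · intro e
    induction e with | _ u v
    intro h
    rw [SimpleGraph.mem_edgeSet] at h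
    have h1 : σ u ≠ v := fun e => h (e ▸ hσ u)
    have h2 : σ v ≠ u := fun e => h (e ▸ hσ v).symm
    simp [h1, h2]
  · intro v
    simp only [Sym2.lift_mk, Finset.sum_add_distrib, ← Finset.mul_sum]
    have h1 (u : W) : σ u = v ↔ u = σ.symm v := by rw [Equiv.eq_symm_apply]
    simp [h1]
    norm_num

theorem IsDecomp.hasPerfectTwoMatching [DecidableEq V] (h : IsDecomp G X Y) :
    HasPerfectTwoMatching (G.induce (((X ∪ Y)ᶜ : Finset V) : Set V)) := by
  classical
  set H := G.induce (((X ∪ Y)ᶜ : Finset V) : Set V) with hH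
  obtain ⟨f, hf, hfa⟩ := (Finset.all_card_le_biUnion_card_iff_exists_injective
    (fun v => Finset.univ.filter fun w => H.Adj v w)).1 (fun O => by
      have hO {v : V} (hv : v ∈ O.map (Function.Embedding.subtype _)) : v ∉ X ∧ v ∉ Y := by
        obtain ⟨w, -, rfl⟩ := Finset.mem_map.1 hv
        have := w.2
        simpa using this
      obtain ⟨T, hTX, hTY, hT, hc⟩ := h.hall_rest (O.map (Function.Embedding.subtype _))
        (Finset.disjoint_left.2 fun v hv => (hO hv).1)
        (Finset.disjoint_left.2 fun v hv => (hO hv).2)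
      rw [Finset.card_map] at hc
      have hTm (v : V) (hv : v ∈ T) : v ∈ (((X ∪ Y)ᶜ : Finset V) : Set V) := by
        simpa using ⟨Finset.disjoint_left.1 hTX hv, Finset.disjoint_left.1 hTY hv⟩
      calc O.card ≤ T.card := hc
        _ = (T.subtype (· ∈ (((X ∪ Y)ᶜ : Finset V) : Set V))).card := by
          rw [Finset.card_subtype, Finset.filter_true_of_mem hTm]
        _ ≤ _ := Finset.card_le_card fun v hv => by
          obtain ⟨u, hu, huv⟩ := hT v (Finset.mem_subtype.1 hv)
          obtain ⟨w, hw, rfl⟩ := Finset.mem_map.1 hu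
          exact Finset.mem_biUnion.2 ⟨w, hw, by simpa [hH] using huv⟩)
  refine hasPerfectTwoMatching_of_perm
    (Equiv.ofBijective f (Finite.injective_iff_bijective.1 hf)) fun v => ?_
  simpa using hfa v

end ConjunctiveCapacity
-- The auction: prices separate `Y` from the other objects.
namespace ConjunctiveCapacity

/-- If `f y` lies outside an interval of `n` numbers, then `f` misses one of these numbers. -/
theorem exists_gap {n : ℕ} (f : Fin n → ℕ) (y : Fin n) (a : ℕ) (hy : f y < a ∨ a + n ≤ f y) :
    ∃ k, a ≤ k ∧ k < a + n ∧ ∀ z, f z ≠ k := by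
  by_contra! h
  have h1 : Finset.Ico a (a + n) ⊆ (Finset.univ.erase y).image f := by
    intro k hk
    rw [Finset.mem_Ico] at hk
    obtain ⟨z, hz⟩ := h k hk.1 hk.2
    refine Finset.mem_image.2 ⟨z, Finset.mem_erase.2 ⟨?_, Finset.mem_univ z⟩, hz⟩
    rintro rfl
    omega
  have h2 := (Finset.card_le_card h1).trans Finset.card_image_le
  rw [Nat.card_Ico, Finset.card_erase_of_mem (Finset.mem_univ y), Finset.card_univ,
    Fintype.card_fin] at h2
  have := y.pos
  omega

variable {n : ℕ} {G : SimpleGraph (Fin n)} {X Y : Finset (Fin n)} {p o : Fin n → ℕ}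

/-- The invariant of the auction on the bipartite double cover: `p` are the prices of the objects
`0, …, n - 1`, and `o y = u + 1` means that `y` is assigned to the bidder `u`. -/
structure AuctionInv (G : SimpleGraph (Fin n)) (p o : Fin n → ℕ) : Prop where
  owned : ∀ y, p y ≠ 0 → ∃ u : Fin n, o y = u + 1
  adj : ∀ u y : Fin n, o y = u + 1 → G.Adj u y
  slack : ∀ u y : Fin n, o y = u + 1 → ∀ z, G.Adj u z → p y ≤ p z + 1
  inj : ∀ u y z : Fin n, o y = u + 1 → o z = u + 1 → y = z
  le : ∀ y, p y ≤ 2 * n + 2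

/-- The bidder `u` owns an object, or all objects it wants have the maximal price. -/
def Settled (G : SimpleGraph (Fin n)) (p o : Fin n → ℕ) (u : Fin n) : Prop :=
  (∃ y, o y = u + 1) ∨ ∀ y, G.Adj u y → 2 * n + 2 ≤ p y

theorem AuctionInv.zero : AuctionInv G 0 0 := by
  constructor <;> simp

/-- A cheapest wanted object exceeds the others by at most 1 after the raise. For all other assigned
pairs the slack inequality only weakens, because prices never fall. -/
theorem AuctionInv.bid (h : AuctionInv G p o) {u y : Fin n} (hu : ∀ z, o z ≠ u + 1)
    (huy : G.Adj u y) (hy : ∀ z, G.Adj u z → p y ≤ p z) (hp : p y < 2 * n + 2) :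
    AuctionInv G (Function.update p y (p y + 1)) (Function.update o y (u + 1)) := by
  have mono (z : Fin n) : p z ≤ Function.update p y (p y + 1) z := by
    by_cases hz : z = y
    · subst hz; simp
    · simp [hz]
  constructor
  · intro z hz
    by_cases hzy : z = y
    · subst hzy; exact ⟨u, by simp⟩
    · simp only [Function.update_of_ne hzy] at hz ⊢
      exact h.owned z hz
  · intro v z hz
    by_cases hzy : z = y
    · subst hzy
      simp only [Function.update_self, Nat.add_right_cancel_iff, Fin.val_inj] at hz
      exact hz ▸ huy
    · simp only [Function.update_of_ne hzy] at hz
      exact h.adj v z hz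
  · intro v z hz w hw
    by_cases hzy : z = y
    · subst hzy
      simp only [Function.update_self, Nat.add_right_cancel_iff, Fin.val_inj] at hz
      subst hz
      have := hy w hw
      have := mono w
      rw [Function.update_self]
      omega
    · simp only [Function.update_of_ne hzy] at hz ⊢
      have := h.slack v z hz w hw
      have := mono w
      omega
  · intro v z w hz hw
    by_cases hzy : z = y <;> by_cases hwy : w = y
    · rw [hzy, hwy]
    · subst hzy
      simp only [Function.update_self, Nat.add_right_cancel_iff, Fin.val_inj] at hz
      simp only [Function.update_of_ne hwy] at hw
      exact absurd (hz ▸ hw) (hu w)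
    · subst hwy
      simp only [Function.update_self, Nat.add_right_cancel_iff, Fin.val_inj] at hw
      simp only [Function.update_of_ne hzy] at hz
      exact absurd (hw ▸ hz) (hu z)
    · simp only [Function.update_of_ne hwy, Function.update_of_ne hzy] at hw hz
      exact h.inj v z w hz hw
  · intro z
    by_cases hzy : z = y
    · subst hzy; simp only [Function.update_self]; omega
    · simp only [Function.update_of_ne hzy]; exact h.le z

/-- Prices outside `Y` stay low. -/
theorem AuctionInv.bid_le (h : AuctionInv G p o) (hD : IsDecomp G X Y)
    (hlow : ∀ y ∉ Y, p y ≤ n + 1) {u y : Fin n} (hu : ∀ z, o z ≠ u + 1)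
    (huy : G.Adj u y) (hy : ∀ z, G.Adj u z → p y ≤ p z) :
    ∀ z ∉ Y, Function.update p y (p y + 1) z ≤ n + 1 := by
  classical
  intro z hz
  by_cases hzy : z = y
  swap
  · rw [Function.update_of_ne hzy]; exact hlow z hz
  subst hzy
  rw [Function.update_self]
  by_contra hcon
  -- Here `p z = n + 1` lies just outside `{1, …, n}`, so one of these prices is unused.
  obtain ⟨k, hk1, hk2, hk⟩ := exists_gap p z 1 (by omega)
  set Z := Finset.univ.filter fun w => w ∉ Y ∧ k < p w with hZ
  have memZ {w : Fin n} : w ∈ Z ↔ w ∉ Y ∧ k < p w := by simp [hZ]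
  have hown (w : Fin n) : ∃ v : Fin n, w ∈ Z → o w = v + 1 := by
    by_cases hw : w ∈ Z
    · obtain ⟨v, hv⟩ := h.owned w (by have := (memZ.1 hw).2; omega)
      exact ⟨v, fun _ => hv⟩
    -- An arbitrary value, to make `f` total.
    · exact ⟨u, fun h => absurd h hw⟩
  choose f hf using hown
  have hfinj : Set.InjOn f Z := fun a ha b hb hab =>
    h.inj (f a) a b (hf a ha) (hab ▸ hf b hb)
  have hunot : u ∉ Z.image f := by
    intro hmem
    obtain ⟨w, hw, e⟩ := Finset.mem_image.1 hmem
    exact hu w (e ▸ hf w hw)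
  -- Owners in `f(Z)` see prices at least `k` by slack, hence above the gap; `u` sees only prices at
  -- least `p z`. So these `|Z| + 1` bidders have all their neighbours outside `Y` in `Z`, against
  -- Hall's condition.
  have hnb (v : Fin n) (hv : v ∈ insert u (Z.image f)) :
      (∀ w, G.Adj v w → k < p w) ∧ ∃ w, w ∉ Y ∧ G.Adj v w := by
    rcases Finset.mem_insert.1 hv with rfl | hv
    · exact ⟨fun w hw => by have := hy w hw; omega, z, hz, huy⟩
    · obtain ⟨w, hw, rfl⟩ := Finset.mem_image.1 hv
      refine ⟨fun w' hw' => ?_, w, (memZ.1 hw).1, h.adj _ _ (hf w hw)⟩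
      have := h.slack _ _ (hf w hw) w' hw'
      have := (memZ.1 hw).2
      have := hk w'
      omega
  obtain ⟨T, hTY, hT, hc⟩ := hD.hall (insert u (Z.image f)) (by
    rw [Finset.disjoint_left]
    intro v hv hvX
    obtain ⟨w, hw, hvw⟩ := (hnb v hv).2
    exact hw (hD.adj v hvX w hvw))
  have hTZ : T ⊆ Z := by
    intro w hw
    obtain ⟨v, hv, hvw⟩ := hT w hw
    exact memZ.2 ⟨Finset.disjoint_left.1 hTY hw, (hnb v hv).1 w hvw⟩
  rw [Finset.card_insert_of_notMem hunot, Finset.card_image_of_injOn hfinj] at hc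
  have := Finset.card_le_card hTZ
  omega

/-- Once all bidders are settled, the prices on `Y` are high. -/
theorem AuctionInv.lt_of_settled (h : AuctionInv G p o) (hD : IsDecomp G X Y)
    (hs : ∀ u, Settled G p o u) : ∀ y ∈ Y, n + 1 < p y := by
  classical
  intro y hy
  by_contra hcon
  -- The gap lies in `{n + 2, …, 2n + 1}`, thus above the threshold and below the maximal price.
  -- This is why the maximal price is `2n + 2`.
  obtain ⟨k, hk1, hk2, hk⟩ := exists_gap p y (n + 2) (by omega)
  set L := Y.filter fun w => p w < k with hL
  have memL {w : Fin n} : w ∈ L ↔ w ∈ Y ∧ p w < k := by simp [hL]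
  obtain ⟨T, hTX, hT, hc⟩ := hD.surplus L (Finset.filter_subset _ _)
    ⟨y, memL.2 ⟨hy, by omega⟩⟩
  -- A bidder in `T` sees a price below `k`, so being settled it owns an object; slack and the gap
  -- put that object into `L`. Hence `T` injects into `L`, against the surplus.
  have hown (v : Fin n) (hv : v ∈ T) : ∃ w ∈ L, o w = v + 1 := by
    obtain ⟨w, hw, hwv⟩ := hT v hv
    have h1 := (memL.1 hw).2
    rcases hs v with ⟨z, hz⟩ | h2
    · refine ⟨z, memL.2 ⟨hD.adj v (hTX hv) z (h.adj v z hz), ?_⟩, hz⟩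
      have := h.slack v z hz w hwv.symm
      have := hk z
      omega
    · have := h2 w hwv.symm
      omega
  refine hc.not_ge (Finset.card_le_card_of_injOn (fun v => if hv : v ∈ T then
    (hown v hv).choose else v) (fun v hv => ?_) fun v hv w hw e => ?_)
  · have hv : v ∈ T := hv
    simp only [hv, dif_pos]
    exact (hown v hv).choose_spec.1
  · have hv : v ∈ T := hv
    have hw : w ∈ T := hw
    simp only [hv, hw, dif_pos] at e
    have h1 := (hown v hv).choose_spec.2
    rw [e, (hown w hw).choose_spec.2] at h1
    exact Fin.ext (by omega)

theorem AuctionInv.mem_iff_of_settled (h : AuctionInv G p o) (hD : IsDecomp G X Y)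
    (hlow : ∀ y ∉ Y, p y ≤ n + 1) (hs : ∀ u, Settled G p o u) (u : Fin n) :
    u ∈ X ↔ ∀ y, G.Adj u y → n + 1 < p y := by
  refine ⟨fun hu y hy => h.lt_of_settled hD hs y (hD.adj u hu y hy), fun hu => ?_⟩
  by_contra hX
  obtain ⟨T, hTY, hT, hc⟩ := hD.hall {u} (by simpa using hX)
  obtain ⟨v, hv⟩ := Finset.card_pos.1 ((Finset.card_singleton u).symm ▸ hc : 1 ≤ T.card)
  obtain ⟨w, hw, hwv⟩ := hT v hv
  rw [Finset.mem_singleton] at hw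
  subst hw
  have := hu v hwv
  have := hlow v (Finset.disjoint_left.1 hTY hv)
  omega

end ConjunctiveCapacity
-- A program logic with time bounds.
namespace ConjunctiveCapacity

namespace RamProg

/-- Started in `s`, the program halts within `T` steps in a state that satisfies `Q`. -/
def Post (a : RamProg) (T : ℕ) (s : RamState) (Q : RamState → Prop) : Prop :=
  ∃ t s', RamExec a s t s' ∧ t ≤ T ∧ Q s'

/-- Weakest precondition of a program without loops. -/
def wp : RamProg → (RamState → Prop) → RamState → Prop
  | const d c, Q, s => Q ⟨Function.update s.reg d c, s.mem⟩
  | add d i j, Q, s => Q ⟨Function.update s.reg d (s.reg i + s.reg j), s.mem⟩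
  | sub d i j, Q, s => Q ⟨Function.update s.reg d (s.reg i - s.reg j), s.mem⟩
  | load d i, Q, s => Q ⟨Function.update s.reg d (s.mem (s.reg i)), s.mem⟩
  | store i j, Q, s => Q ⟨s.reg, Function.update s.mem (s.reg i) (s.reg j)⟩
  | seq a b, Q, s => wp a (wp b Q) s
  | ite i a b, Q, s => (s.reg i ≠ 0 → wp a Q s) ∧ (s.reg i = 0 → wp b Q s)
  | loop _ _, _, _ => False

/-- A bound on the running time of a program without loops. -/
def cost : RamProg → ℕ
  | seq a b => cost a + cost b
  | ite _ a b => cost a + cost b + 1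
  | _ => 1

theorem Post.mono {a : RamProg} {T T' : ℕ} {s : RamState} {Q Q' : RamState → Prop}
    (h : Post a T s Q) (hT : T ≤ T') (hQ : ∀ s', Q s' → Q' s') : Post a T' s Q' := by
  obtain ⟨t, s', h1, h2, h3⟩ := h
  exact ⟨t, s', h1, h2.trans hT, hQ s' h3⟩

theorem Post.seq {a b : RamProg} {T T' : ℕ} {s : RamState} {Q R : RamState → Prop}
    (h : Post a T s R) (h' : ∀ s', R s' → Post b T' s' Q) : Post (seq a b) (T + T') s Q := by
  obtain ⟨t, s', h1, h2, h3⟩ := h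
  obtain ⟨t', s'', h4, h5, h6⟩ := h' s' h3
  exact ⟨t + t', s'', .seq h1 h4, add_le_add h2 h5, h6⟩

theorem Post.of_wp {a : RamProg} {s : RamState} {Q : RamState → Prop} (h : wp a Q s) :
    Post a a.cost s Q := by
  induction a generalizing s Q with
  | const d c => exact ⟨1, _, .const d c s, le_rfl, h⟩
  | add d i j => exact ⟨1, _, .add d i j s, le_rfl, h⟩
  | sub d i j => exact ⟨1, _, .sub d i j s, le_rfl, h⟩
  | load d i => exact ⟨1, _, .load d i s, le_rfl, h⟩
  | store i j => exact ⟨1, _, .store i j s, le_rfl, h⟩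
  | seq a b iha ihb => exact (iha h).seq fun s' hs' => ihb hs'
  | ite i a b iha ihb =>
    by_cases hi : s.reg i = 0
    · obtain ⟨t, s', h1, h2, h3⟩ := ihb (h.2 hi)
      exact ⟨t + 1, s', .ite_false hi h1, by simp only [cost]; omega, h3⟩
    · obtain ⟨t, s', h1, h2, h3⟩ := iha (h.1 hi)
      exact ⟨t + 1, s', .ite_true hi h1, by simp only [cost]; omega, h3⟩
  | loop i a => exact h.elim

/-- Lets a specification of the first two of three commands be used although programs nest to the
right. -/
theorem Post.seq_assoc {a b c : RamProg} {T : ℕ} {s : RamState} {Q : RamState → Prop}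
    (h : Post (.seq (.seq a b) c) T s Q) : Post (.seq a (.seq b c)) T s Q := by
  obtain ⟨t, s', h1, h2, h3⟩ := h
  cases h1 with
  | seq h4 h5 =>
    cases h4 with
    | seq h6 h7 => exact ⟨_, s', .seq h6 (.seq h7 h5), by rwa [← add_assoc], h3⟩

/-- A loop whose register counts down to `0`. -/
theorem Post.loop {i : ℕ} {a : RamProg} {B : ℕ} (Inv : ℕ → RamState → Prop)
    (hreg : ∀ k s, Inv k s → s.reg i = k) (h : ∀ k s, Inv (k + 1) s → Post a B s (Inv k)) :
    ∀ k s, Inv k s → Post (loop i a) (k * (B + 1) + 1) s (Inv 0) := by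
  intro k
  induction k with
  | zero => exact fun s hs => ⟨1, s, by constructor; exact hreg 0 s hs, by omega, hs⟩
  | succ k ih =>
    intro s hs
    obtain ⟨t, s', h1, h2, h3⟩ := h k s hs
    obtain ⟨t', s'', h4, h5, h6⟩ := ih s' h3
    refine ⟨t + t' + 1, s'', .loop_step ?_ h1 h4, ?_, h6⟩
    · rw [hreg _ _ hs]; omega
    · rw [add_mul]; omega

end RamProg

open RamProg

/-! The auction as a program. Registers: `0` holds `n`, `1` holds `1`, `2` the maximal price
`2 * n + 2`, `3` the threshold `n + 1`, `4` the address `n * n` of the prices (followed by the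
owners), `5` holds `0`; `6`, `7`, `8`, `12` are loop counters, `9` holds the current bidder plus
one, `10` counts the bidders that see only prices above the threshold, `11` points into the
adjacency matrix and `13` to the current price; `14` and `15` hold the minimal price and its
address, `16` is nonzero if the bidder owns nothing, and `17`, `18`, `19` are scratch. -/

/-- Update the minimal price by the current object. -/
def relaxProg : RamProg :=
  .seq (.load 17 11) (.ite 17
    (.seq (.load 17 13) (.seq (.sub 18 14 17)
      (.ite 18 (.seq (.add 14 17 5) (.add 15 13 5)) (.const 19 0))))
    (.const 19 0))

/-- Clear the flag if the bidder owns the current object, and advance to the next object. -/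
def ownerProg : RamProg :=
  .seq (.add 18 13 0) (.seq (.load 17 18) (.seq (.sub 18 17 9) (.seq (.sub 17 9 17)
    (.seq (.add 17 17 18) (.seq (.ite 17 (.const 19 0) (.const 16 0))
      (.seq (.add 11 11 1) (.seq (.add 13 13 1) (.sub 12 12 1))))))))

def startProg : RamProg :=
  .seq (.const 16 1) (.seq (.add 14 2 5) (.seq (.add 13 4 5) (.add 12 0 5)))

def countProg : RamProg :=
  .seq (.sub 17 14 3) (.ite 17 (.add 10 10 1) (.const 19 0))

def bidProg : RamProg :=
  .seq (.sub 17 2 14) (.seq (.ite 17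
    (.ite 16 (.seq (.add 14 14 1) (.seq (.store 15 14) (.seq (.add 17 15 0) (.store 17 9))))
      (.const 19 0))
    (.const 19 0)) (.seq (.add 9 9 1) (.sub 8 8 1)))

/-- Let one bidder bid. -/
def bidderProg : RamProg :=
  .seq startProg (.seq (.loop 12 (.seq relaxProg ownerProg)) (.seq countProg bidProg))

def sweepStartProg : RamProg :=
  .seq (.const 9 1) (.seq (.const 10 0) (.seq (.const 11 0) (.add 8 0 5)))

/-- Let all bidders bid in turn. -/
def sweepProg : RamProg :=
  .seq sweepStartProg (.loop 8 bidderProg)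

def initProg : RamProg :=
  .seq (.const 1 1) (.seq (.add 2 0 0) (.seq (.add 2 2 1) (.seq (.add 2 2 1)
    (.seq (.add 3 0 1) (.add 6 0 5)))))

def squareProg : RamProg :=
  .loop 6 (.seq (.add 4 4 0) (.sub 6 6 1))

def innerProg : RamProg :=
  .loop 7 (.seq sweepProg (.sub 7 7 1))

def outerProg : RamProg :=
  .loop 6 (.seq (.add 7 0 5) (.seq innerProg (.sub 6 6 1)))

def auctionProg : RamProg :=
  .seq initProg (.seq squareProg (.seq (.add 6 2 5) (.seq outerProg
    (.seq sweepProg (.add 0 10 5)))))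

/-! ### Memory layout and one step of the scan. -/

variable {n : ℕ} {G : SimpleGraph (Fin n)} {X Y : Finset (Fin n)} {p o : Fin n → ℕ}

/-- The memory holds the graph, the prices and the owners. -/
structure MemRep (G : SimpleGraph (Fin n)) (p o : Fin n → ℕ) (m : ℕ → ℕ) : Prop where
  graph : ∀ i j : Fin n, m (i * n + j) ≠ 0 ↔ G.Adj i j
  price : ∀ y : Fin n, m (n * n + y) = p y
  owner : ∀ y : Fin n, m (n * n + y + n) = o y

/-- Keeps the adjacency matrix apart from the prices and owners stored behind it. -/
theorem mul_add_lt (i j : Fin n) : (i : ℕ) * n + j < n * n := by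
  calc (i : ℕ) * n + j < i * n + n := by omega
    _ = (i + 1) * n := by ring
    _ ≤ n * n := Nat.mul_le_mul_right n i.2

theorem MemRep.update {m : ℕ → ℕ} (h : MemRep G p o m) (y : Fin n) (a b : ℕ) :
    MemRep G (Function.update p y a) (Function.update o y b)
      (Function.update (Function.update m (n * n + y) a) (n * n + y + n) b) := by
  constructor
  · intro i j
    have h1 := mul_add_lt i j
    rw [Function.update_of_ne (by omega), Function.update_of_ne (by omega)]
    exact h.graph i j
  · intro z
    rw [Function.update_of_ne (by omega)]
    by_cases hz : z = y
    · subst hz; simp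
    · rw [Function.update_of_ne (by omega), Function.update_of_ne hz]; exact h.price z
  · intro z
    by_cases hz : z = y
    · subst hz; simp
    · rw [Function.update_of_ne (by omega), Function.update_of_ne (by omega),
        Function.update_of_ne hz]
      exact h.owner z

/-- The registers that are constant during the auction. -/
structure Globals (n : ℕ) (r : ℕ → ℕ) : Prop where
  r0 : r 0 = n
  r1 : r 1 = 1
  r2 : r 2 = 2 * n + 2
  r3 : r 3 = n + 1
  r4 : r 4 = n * n
  r5 : r 5 = 0

theorem Globals.congr {r r' : ℕ → ℕ} (h : Globals n r) (e : ∀ i ≤ 5, r' i = r i) :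
    Globals n r' :=
  ⟨(e 0 (by omega)).trans h.r0, (e 1 (by omega)).trans h.r1, (e 2 (by omega)).trans h.r2,
    (e 3 (by omega)).trans h.r3, (e 4 (by omega)).trans h.r4, (e 5 (by omega)).trans h.r5⟩

/-- The bidder `u` has found the minimal price `a` at the address `b` among the first `j` objects. -/
structure MinFound (G : SimpleGraph (Fin n)) (p : Fin n → ℕ) (u : Fin n) (j a b : ℕ) : Prop where
  le : a ≤ 2 * n + 2
  min : ∀ y : Fin n, y < j → G.Adj u y → a ≤ p y
  attained : a < 2 * n + 2 → ∃ y : Fin n, G.Adj u y ∧ p y = a ∧ b = n * n + y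

/-- The flag `c` is nonzero if the bidder `u` owns none of the first `j` objects. -/
def FlagFound (o : Fin n → ℕ) (u : Fin n) (j c : ℕ) : Prop :=
  (c ≠ 0 ∧ ∀ y : Fin n, y < j → o y ≠ u + 1) ∨ (c = 0 ∧ ∃ y : Fin n, o y = u + 1)

theorem relaxProg_spec {s : RamState} (hg : Globals n s.reg) (hm : MemRep G p o s.mem)
    (u y : Fin n) (h11 : s.reg 11 = u * n + y) (h13 : s.reg 13 = n * n + y)
    (hf : MinFound G p u y (s.reg 14) (s.reg 15)) :
    Post relaxProg relaxProg.cost s fun s' => s'.mem = s.mem ∧ (∀ r ≤ 13, s'.reg r = s.reg r) ∧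
      s'.reg 16 = s.reg 16 ∧ MinFound G p u (y + 1) (s'.reg 14) (s'.reg 15) := by
  have hp := hm.price y
  have hadj := hm.graph u y
  have frame {a b : ℕ} (h : a ≤ 13) (h' : 13 < b) : a ≠ b := by omega
  have last {z : Fin n} (hz : (z : ℕ) < y + 1) (hne : ¬ (z : ℕ) < y) : z = y :=
    Fin.ext (by omega)
  apply Post.of_wp
  simp only [relaxProg, wp, Function.update_self, ne_eq, Nat.reduceEqDiff,
    not_false_eq_true, Function.update_of_ne, h11, h13, hp, hg.r5, add_zero, true_and]
  refine ⟨fun h => ⟨fun h' => ⟨fun r hr => ?_, ?_⟩, fun h' => ⟨fun r hr => ?_, ?_⟩⟩,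
    fun h => ⟨fun r hr => ?_, ?_⟩⟩
  · simp [frame hr]
  · refine ⟨by have := hf.le; omega, fun z hz hzu => ?_, fun _ => ⟨y, hadj.1 h, rfl, rfl⟩⟩
    by_cases hzy : (z : ℕ) < y
    · have := hf.min z hzy hzu; omega
    · rw [last hz hzy]
  · simp [frame hr]
  · refine ⟨hf.le, fun z hz hzu => ?_, hf.attained⟩
    by_cases hzy : (z : ℕ) < y
    · exact hf.min z hzy hzu
    · rw [last hz hzy]; omega
  · simp [frame hr]
  · refine ⟨hf.le, fun z hz hzu => ?_, hf.attained⟩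
    by_cases hzy : (z : ℕ) < y
    · exact hf.min z hzy hzu
    · rw [last hz hzy] at hzu; exact absurd h (hadj.2 hzu)

/-- Equality of owner and bidder is tested by adding the two truncated differences: the sum is 0
exactly if they agree. -/
theorem ownerProg_spec {s : RamState} (hg : Globals n s.reg) (hm : MemRep G p o s.mem)
    (u y : Fin n) (h9 : s.reg 9 = u + 1) (h13 : s.reg 13 = n * n + y)
    (hf : FlagFound o u y (s.reg 16)) :
    Post ownerProg ownerProg.cost s fun s' => s'.mem = s.mem ∧ (∀ r ≤ 10, s'.reg r = s.reg r) ∧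
      s'.reg 11 = s.reg 11 + 1 ∧ s'.reg 12 = s.reg 12 - 1 ∧ s'.reg 13 = s.reg 13 + 1 ∧
      s'.reg 14 = s.reg 14 ∧ s'.reg 15 = s.reg 15 ∧ FlagFound o u (y + 1) (s'.reg 16) := by
  have ho := hm.owner y
  have frame {a b : ℕ} (h : a ≤ 10) (h' : 10 < b) : a ≠ b := by omega
  apply Post.of_wp
  simp only [ownerProg, wp, Function.update_self, ne_eq, Nat.reduceEqDiff,
    not_false_eq_true, Function.update_of_ne, h9, h13, ho, hg.r0, hg.r1, true_and,
    OfNat.one_ne_ofNat]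
  refine ⟨fun h => ⟨fun r hr => ?_, ?_⟩, fun h => ⟨fun r hr => ?_, ?_⟩⟩
  · simp [frame hr]
  · rcases hf with ⟨h1, h2⟩ | h1
    · refine .inl ⟨h1, fun z hz => ?_⟩
      by_cases hzy : (z : ℕ) < y
      · exact h2 z hzy
      · rw [show z = y from Fin.ext (by omega)]; omega
    · exact .inr h1
  · simp [frame hr]
  · exact .inr ⟨rfl, y, by omega⟩

end ConjunctiveCapacity
-- One bidder, sweeps and termination.
namespace ConjunctiveCapacity

open RamProg

variable {n : ℕ} {G : SimpleGraph (Fin n)} {X Y : Finset (Fin n)} {p o : Fin n → ℕ}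

/-- The time of the scan of all objects for one bidder. -/
def scanTime (n : ℕ) : ℕ := n * (relaxProg.cost + ownerProg.cost + 1) + 1

theorem scan_spec {s : RamState} (hg : Globals n s.reg) (hm : MemRep G p o s.mem) (u : Fin n)
    (h9 : s.reg 9 = u + 1) (h11 : s.reg 11 = u * n) :
    Post (.seq startProg (.loop 12 (.seq relaxProg ownerProg))) (startProg.cost + scanTime n) s
      fun s' => s'.mem = s.mem ∧ (∀ r ≤ 10, s'.reg r = s.reg r) ∧ s'.reg 11 = (u + 1) * n ∧
        MinFound G p u n (s'.reg 14) (s'.reg 15) ∧ FlagFound o u n (s'.reg 16) := by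
  let Inv : ℕ → RamState → Prop := fun k s' => ∃ y, y + k = n ∧ s'.mem = s.mem ∧
    (∀ r ≤ 10, s'.reg r = s.reg r) ∧ s'.reg 11 = u * n + y ∧ s'.reg 12 = k ∧
    s'.reg 13 = n * n + y ∧ MinFound G p u y (s'.reg 14) (s'.reg 15) ∧ FlagFound o u y (s'.reg 16)
  have h1 : Post startProg startProg.cost s (Inv n) := by
    have frame {a b : ℕ} (h : a ≤ 10) (h' : 10 < b) : a ≠ b := by omega
    apply Post.of_wp
    simp only [startProg, wp, ne_eq, Nat.reduceEqDiff, not_false_eq_true,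
      Function.update_of_ne, hg.r0, hg.r2, hg.r4, hg.r5, add_zero, OfNat.zero_ne_ofNat]
    refine ⟨0, by omega, rfl, fun r hr => ?_, ?_, ?_, ?_, ?_, ?_⟩
    · simp [frame hr]
    · simp [h11]
    · simp
    · simp
    -- The search starts from the maximal price `2n + 2` as a sentinel, so no address is needed yet.
    · exact ⟨by simp, fun y hy => absurd hy (by omega), fun h => by simp at h⟩
    · exact .inl ⟨by simp, fun y hy => absurd hy (by omega)⟩
  refine h1.seq fun s1 hs1 => (Post.loop Inv (fun k t ⟨y, h⟩ => h.2.2.2.2.1) ?_ n s1 hs1).mono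
    le_rfl ?_
  · rintro k t ⟨y, hy, ht, hr, ht11, ht12, ht13, hmin, hflag⟩
    have hg' : Globals n t.reg := hg.congr fun i hi => hr i (by omega)
    have hyn : y < n := by omega
    refine (relaxProg_spec hg' (ht ▸ hm) u ⟨y, hyn⟩ ht11 ht13 hmin).seq ?_
    rintro t' ⟨ht', hr', ht16, hmin'⟩
    have hg'' : Globals n t'.reg := hg'.congr fun i hi => hr' i (by omega)
    refine (ownerProg_spec hg'' (by rw [ht', ht]; exact hm) u ⟨y, hyn⟩
      (by rw [hr' 9 (by omega), hr 9 (by omega), h9]) (by rw [hr' 13 (by omega), ht13])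
      (by rw [ht16]; exact hflag)).mono le_rfl ?_
    rintro t'' ⟨hm'', hr'', e11, e12, e13, e14, e15, hflag'⟩
    refine ⟨y + 1, by omega, by rw [hm'', ht', ht], fun r hr0 => ?_, ?_, ?_, ?_, ?_, hflag'⟩
    · rw [hr'' r hr0, hr' r (by omega), hr r hr0]
    · rw [e11, hr' 11 (by omega), ht11, add_assoc]
    · rw [e12, hr' 12 (by omega), ht12, Nat.add_sub_cancel]
    · rw [e13, hr' 13 (by omega), ht13, add_assoc]
    · rw [e14, e15]; exact hmin'
  · rintro t ⟨y, hy, ht, hr, ht11, -, -, hmin, hflag⟩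
    obtain rfl : y = n := by omega
    exact ⟨ht, hr, by rw [ht11]; ring, hmin, hflag⟩

/-- All objects that `u` wants have prices above the threshold. -/
def SeesHigh (G : SimpleGraph (Fin n)) (p : Fin n → ℕ) (u : Fin n) : Prop :=
  ∀ y, G.Adj u y → n + 1 < p y

open Classical in
/-- The number of bidders among the first `j` that see only prices above the threshold. -/
noncomputable def highCount (G : SimpleGraph (Fin n)) (p : Fin n → ℕ) (j : ℕ) : ℕ :=
  (Finset.univ.filter fun v : Fin n => (v : ℕ) < j ∧ SeesHigh G p v).card

open Classical in
theorem highCount_succ (u : Fin n) :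
    highCount G p (u + 1) = highCount G p u + if SeesHigh G p u then 1 else 0 := by
  have h : (Finset.univ.filter fun v : Fin n => (v : ℕ) < u + 1 ∧ SeesHigh G p v) =
      (Finset.univ.filter fun v : Fin n => (v : ℕ) < u ∧ SeesHigh G p v) ∪
        if SeesHigh G p u then {u} else ∅ := by
    ext v
    have : (v : ℕ) < u + 1 ↔ (v : ℕ) < u ∨ v = u := by rw [Fin.ext_iff]; omega
    split_ifs with hu <;> simp only [Finset.mem_filter, Finset.mem_univ, true_and,
      Finset.mem_union, Finset.mem_singleton, Finset.notMem_empty, this] <;> grind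
  rw [highCount, h, Finset.card_union_of_disjoint, highCount]
  · split_ifs <;> simp
  · split_ifs <;> simp

open Classical in
theorem countProg_spec {s : RamState} (hg : Globals n s.reg) (u : Fin n)
    (hmin : MinFound G p u n (s.reg 14) (s.reg 15)) :
    Post countProg countProg.cost s fun s' => s'.mem = s.mem ∧
      (∀ r ≤ 16, r ≠ 10 → s'.reg r = s.reg r) ∧
      s'.reg 10 = s.reg 10 + if SeesHigh G p u then 1 else 0 := by
  have frame {a b : ℕ} (h : a ≤ 16) (h' : 16 < b) : a ≠ b := by omega
  apply Post.of_wp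
  simp only [countProg, wp, Function.update_self, ne_eq, Nat.reduceEqDiff, not_false_eq_true,
    Function.update_of_ne, hg.r1, hg.r3, true_and, OfNat.one_ne_ofNat]
  refine ⟨fun h => ⟨fun r hr hr' => ?_, ?_⟩, fun h => ⟨fun r hr hr' => ?_, ?_⟩⟩
  · simp [frame hr, hr']
  · rw [if_pos (show SeesHigh G p u from fun y hy => ?_)]
    have := hmin.min y y.2 hy
    omega
  · simp [frame hr]
  · rw [if_neg fun hu => ?_, add_zero]
    obtain ⟨y, hy, hpy, -⟩ := hmin.attained (by omega)
    have := hu y hy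
    omega

/-- The effect of a bidder on prices, owners and memory: nothing if it is settled, or a bid. -/
def BidResult (G : SimpleGraph (Fin n)) (p o : Fin n → ℕ) (u : Fin n) (m m' : ℕ → ℕ) : Prop :=
  (m' = m ∧ Settled G p o u) ∨
    ∃ y, (∀ z, o z ≠ u + 1) ∧ G.Adj u y ∧ (∀ z, G.Adj u z → p y ≤ p z) ∧ p y < 2 * n + 2 ∧
      MemRep G (Function.update p y (p y + 1)) (Function.update o y (u + 1)) m'

theorem bidProg_spec {s : RamState} (hg : Globals n s.reg) (hm : MemRep G p o s.mem) (u : Fin n)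
    (h9 : s.reg 9 = u + 1) (hmin : MinFound G p u n (s.reg 14) (s.reg 15))
    (hflag : FlagFound o u n (s.reg 16)) :
    Post bidProg bidProg.cost s fun s' => (∀ r ≤ 7, s'.reg r = s.reg r) ∧
      s'.reg 8 = s.reg 8 - 1 ∧ s'.reg 9 = s.reg 9 + 1 ∧ s'.reg 10 = s.reg 10 ∧
      s'.reg 11 = s.reg 11 ∧ BidResult G p o u s.mem s'.mem := by
  have frame {a b : ℕ} (h : a ≤ 7) (h' : 7 < b) : a ≠ b := by omega
  apply Post.of_wp
  simp only [bidProg, wp, Function.update_self, ne_eq, Nat.reduceEqDiff, not_false_eq_true,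
    Function.update_of_ne, hg.r0, hg.r1, hg.r2, true_and, OfNat.one_ne_ofNat, OfNat.zero_ne_ofNat]
  refine ⟨fun h => ⟨fun h' => ⟨fun r hr => ?_, ?_⟩, fun h' => ⟨fun r hr => ?_, ?_⟩⟩,
    fun h => ⟨fun r hr => ?_, ?_⟩⟩
  · simp [frame hr]
  · obtain ⟨y, hy, hpy, hb⟩ := hmin.attained (by omega)
    rcases hflag with ⟨-, hf⟩ | ⟨h1, -⟩
    · refine .inr ⟨y, fun z => hf z z.2, hy, fun z hz => hpy ▸ hmin.min z z.2 hz, by omega, ?_⟩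
      rw [hb, h9, ← hpy]
      exact hm.update y _ _
    · exact absurd h1 h'
  · simp [frame hr]
  · refine .inl ⟨rfl, .inl ?_⟩
    rcases hflag with ⟨h1, -⟩ | ⟨-, h1⟩
    · exact absurd h' h1
    · exact h1
  · simp [frame hr]
  · refine .inl ⟨rfl, .inr fun y hy => ?_⟩
    have := hmin.min y y.2 hy
    omega

/-- The time of one bidder. -/
def bidderTime (n : ℕ) : ℕ :=
  startProg.cost + (scanTime n + (countProg.cost + bidProg.cost))

open Classical in
theorem bidderProg_spec {s : RamState} (hg : Globals n s.reg) (hm : MemRep G p o s.mem) (u : Fin n)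
    (h9 : s.reg 9 = u + 1) (h11 : s.reg 11 = u * n) :
    Post bidderProg (bidderTime n) s fun s' => (∀ r ≤ 7, s'.reg r = s.reg r) ∧
      s'.reg 8 = s.reg 8 - 1 ∧ s'.reg 9 = s.reg 9 + 1 ∧
      s'.reg 10 = s.reg 10 + (if SeesHigh G p u then 1 else 0) ∧
      s'.reg 11 = (u + 1) * n ∧ BidResult G p o u s.mem s'.mem := by
  refine Post.seq_assoc (((scan_spec hg hm u h9 h11).seq (T' := countProg.cost + bidProg.cost)
    ?_).mono (by rw [bidderTime, add_assoc]) fun _ h => h)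
  rintro s1 ⟨hm1, hr1, e11, hmin, hflag⟩
  have hg1 : Globals n s1.reg := hg.congr fun i hi => hr1 i (by omega)
  refine (countProg_spec hg1 u hmin).seq ?_
  rintro s2 ⟨hm2, hr2, e10⟩
  have hg2 : Globals n s2.reg := hg1.congr fun i hi => hr2 i (by omega) (by omega)
  refine (bidProg_spec hg2 (by rw [hm2, hm1]; exact hm) u ?_ ?_ ?_).mono le_rfl ?_
  · rw [hr2 9 (by omega) (by omega), hr1 9 (by omega), h9]
  · rw [hr2 14 (by omega) (by omega), hr2 15 (by omega) (by omega)]; exact hmin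
  · rw [hr2 16 (by omega) (by omega)]; exact hflag
  rintro s3 ⟨hr3, e8, e9, e10', e11', hb⟩
  refine ⟨fun r hr => ?_, ?_, ?_, ?_, ?_, ?_⟩
  · rw [hr3 r hr, hr2 r (by omega) (by omega), hr1 r (by omega)]
  · rw [e8, hr2 8 (by omega) (by omega), hr1 8 (by omega)]
  · rw [e9, hr2 9 (by omega) (by omega), hr1 9 (by omega)]
  · rw [e10', e10, hr1 10 (by omega)]
  · rw [e11', hr2 11 (by omega) (by omega), e11]
  · rwa [hm2, hm1] at hb

/-- The invariant of the auction on a graph with a decomposition. -/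
structure GoodState (G : SimpleGraph (Fin n)) (Y : Finset (Fin n)) (p o : Fin n → ℕ)
    (m : ℕ → ℕ) : Prop where
  rep : MemRep G p o m
  inv : AuctionInv G p o
  low : ∀ y ∉ Y, p y ≤ n + 1

/-- The progress of a sweep from `p`, `o` to `p'`, `o'` after the first `j` bidders, where `c` is
the count of the bidders that see only high prices. -/
def Progress (G : SimpleGraph (Fin n)) (p o p' o' : Fin n → ℕ) (j c : ℕ) : Prop :=
  ((¬ ∀ u, Settled G p o u) ∧ ∑ y, p y < ∑ y, p' y) ∨
    (p' = p ∧ o' = o ∧ (∀ u : Fin n, u < j → Settled G p o u) ∧ c = highCount G p j)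

theorem sum_update_succ (p : Fin n → ℕ) (y : Fin n) :
    ∑ z, Function.update p y (p y + 1) z = ∑ z, p z + 1 := by
  rw [Finset.sum_update_of_mem (Finset.mem_univ y), Finset.sdiff_singleton_eq_erase,
    ← Finset.add_sum_erase Finset.univ p (Finset.mem_univ y)]
  ring

open Classical in
-- The first bid of a sweep happens while prices and owners are still the initial ones, so its
-- bidder shows that not all were settled. Later bids only raise the sum further.
theorem Progress.step {p' o' : Fin n → ℕ} {m m' : ℕ → ℕ} {c : ℕ} (hD : IsDecomp G X Y)
    (u : Fin n) (h : GoodState G Y p' o' m) (hp : Progress G p o p' o' u c)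
    (hb : BidResult G p' o' u m m') :
    ∃ p'' o'', GoodState G Y p'' o'' m' ∧
      Progress G p o p'' o'' (u + 1) (c + if SeesHigh G p' u then 1 else 0) := by
  rcases hb with ⟨rfl, hs⟩ | ⟨y, hu, huy, hy, hlt, hrep⟩
  · refine ⟨p', o', h, ?_⟩
    rcases hp with hp | ⟨rfl, rfl, h1, h2⟩
    · exact .inl hp
    · refine .inr ⟨rfl, rfl, fun v hv => ?_, by rw [highCount_succ, h2]⟩
      by_cases hvu : v = u
      · exact hvu ▸ hs
      · exact h1 v (by rw [Fin.ext_iff] at hvu; omega)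
  · refine ⟨_, _, ⟨hrep, h.inv.bid hu huy hy hlt, h.inv.bid_le hD h.low hu huy hy⟩, .inl ?_⟩
    rw [sum_update_succ]
    rcases hp with hp | ⟨rfl, rfl, -, -⟩
    · exact ⟨hp.1, hp.2.trans (Nat.lt_succ_self _)⟩
    · refine ⟨fun hs => ?_, Nat.lt_succ_self _⟩
      rcases hs u with ⟨z, hz⟩ | h1
      · exact hu z hz
      · have := h1 y huy
        omega

/-- The time of a sweep. -/
def sweepTime (n : ℕ) : ℕ := sweepStartProg.cost + (n * (bidderTime n + 1) + 1)

theorem sweepProg_spec {s : RamState} (hD : IsDecomp G X Y) (hg : Globals n s.reg)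
    (h : GoodState G Y p o s.mem) :
    Post sweepProg (sweepTime n) s fun s' => (∀ r ≤ 7, s'.reg r = s.reg r) ∧
      ∃ p' o', GoodState G Y p' o' s'.mem ∧ Progress G p o p' o' n (s'.reg 10) := by
  let Inv : ℕ → RamState → Prop := fun k s' => ∃ j, j + k = n ∧ (∀ r ≤ 7, s'.reg r = s.reg r) ∧
    s'.reg 8 = k ∧ s'.reg 9 = j + 1 ∧ s'.reg 11 = j * n ∧
    ∃ p' o', GoodState G Y p' o' s'.mem ∧ Progress G p o p' o' j (s'.reg 10)
  have h1 : Post sweepStartProg sweepStartProg.cost s (Inv n) := by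
    have frame {a b : ℕ} (h : a ≤ 7) (h' : 7 < b) : a ≠ b := by omega
    apply Post.of_wp
    simp only [sweepStartProg, wp, ne_eq, Nat.reduceEqDiff, not_false_eq_true,
      Function.update_of_ne, hg.r0, hg.r5, add_zero, OfNat.zero_ne_ofNat]
    refine ⟨0, by omega, fun r hr => ?_, ?_, ?_, ?_, p, o, h, .inr ⟨rfl, rfl, ?_, ?_⟩⟩
    · simp [frame hr]
    · simp
    · simp
    · simp
    · exact fun u hu => absurd hu (by omega)
    · simp [highCount]
  refine h1.seq fun s1 hs1 => (Post.loop Inv (fun k t ⟨y, h⟩ => h.2.2.1) ?_ n s1 hs1).mono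
    le_rfl ?_
  · rintro k t ⟨j, hj, hr, h8, h9, h11, p', o', hgood, hpr⟩
    have hg' : Globals n t.reg := hg.congr fun i hi => hr i (by omega)
    have hjn : j < n := by omega
    refine (bidderProg_spec hg' hgood.rep ⟨j, hjn⟩ h9 h11).mono le_rfl ?_
    rintro t' ⟨hr', e8, e9, e10, e11, hb⟩
    refine ⟨j + 1, by omega, fun r hr0 => by rw [hr' r hr0, hr r hr0], by omega, by omega, e11, ?_⟩
    rw [e10]
    exact hpr.step hD ⟨j, hjn⟩ hgood hb
  · rintro t ⟨j, hj, hr, -, -, -, h⟩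
    obtain rfl : j = n := by omega
    exact ⟨hr, h⟩

/-- All bidders are settled, or the prices are so high that at most `d` more sweeps are needed. -/
def Near (G : SimpleGraph (Fin n)) (p o : Fin n → ℕ) (d : ℕ) : Prop :=
  (∀ u, Settled G p o u) ∨ (2 * n + 2) * n ≤ ∑ y, p y + d

theorem Progress.near {p' o' : Fin n → ℕ} {c d : ℕ} (h : Progress G p o p' o' n c)
    (hn : Near G p o (d + 1)) : Near G p' o' d := by
  rcases h with ⟨h1, h2⟩ | ⟨rfl, rfl, h1, -⟩
  · rcases hn with hn | hn
    · exact absurd hn h1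
    · exact .inr (by omega)
  · exact .inl fun u => h1 u u.2

/-- If the sum of the prices has reached `(2n + 2)n`, every price is maximal and there is nothing
left to bid on. -/
theorem Near.settled (h : AuctionInv G p o) (hn : Near G p o 0) (u : Fin n) :
    Settled G p o u := by
  rcases hn with hn | hn
  · exact hn u
  refine .inr fun y _ => ?_
  by_contra! hy
  have : ∑ y, p y < ∑ _y : Fin n, (2 * n + 2) :=
    Finset.sum_lt_sum (fun z _ => h.le z) ⟨y, Finset.mem_univ y, hy⟩
  rw [Finset.sum_const, Finset.card_univ, Fintype.card_fin, smul_eq_mul, mul_comm] at this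
  omega

/-- The time of `n` sweeps. -/
def innerTime (n : ℕ) : ℕ := n * (sweepTime n + 1 + 1) + 1

theorem innerProg_spec {s : RamState} (hD : IsDecomp G X Y) (hg : Globals n s.reg)
    (h7 : s.reg 7 = n) (d : ℕ) (h : GoodState G Y p o s.mem) (hn : Near G p o (d + n)) :
    Post innerProg (innerTime n) s fun s' => (∀ r ≤ 6, s'.reg r = s.reg r) ∧
      ∃ p' o', GoodState G Y p' o' s'.mem ∧ Near G p' o' d := by
  let Inv : ℕ → RamState → Prop := fun k s' => (∀ r ≤ 6, s'.reg r = s.reg r) ∧ s'.reg 7 = k ∧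
    ∃ p' o', GoodState G Y p' o' s'.mem ∧ Near G p' o' (d + k)
  refine (Post.loop (B := sweepTime n + 1) Inv (fun k t h => h.2.1) ?_ n s
    ⟨fun _ _ => rfl, h7, p, o, h, hn⟩).mono le_rfl fun s' h => ⟨h.1, h.2.2⟩
  rintro k t ⟨hr, h7, p1, o1, hgood, hnear⟩
  refine (sweepProg_spec hD (hg.congr fun i hi => hr i (by omega)) hgood).seq ?_
  rintro t' ⟨hr', p2, o2, hgood', hpr⟩
  refine (Post.of_wp (a := .sub 7 7 1) ?_ :)
  have e1 : t'.reg 1 = 1 := by rw [hr' 1 (by omega), hr 1 (by omega), hg.r1]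
  have e7 : t'.reg 7 = k + 1 := by rw [hr' 7 (by omega), h7]
  refine ⟨fun r hr0 => ?_, by simp [e1, e7], p2, o2, hgood', hpr.near hnear⟩
  simp only [Function.update_of_ne (show r ≠ 7 by omega)]
  rw [hr' r (by omega), hr r hr0]

/-- The time of all sweeps but the last one. -/
def outerTime (n : ℕ) : ℕ := (2 * n + 2) * (1 + (innerTime n + 1) + 1) + 1

theorem outerProg_spec {s : RamState} (hD : IsDecomp G X Y) (hg : Globals n s.reg)
    (h6 : s.reg 6 = 2 * n + 2) (h : GoodState G Y p o s.mem) :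
    Post outerProg (outerTime n) s fun s' => Globals n s'.reg ∧
      ∃ p' o', GoodState G Y p' o' s'.mem ∧ Near G p' o' 0 := by
  let Inv : ℕ → RamState → Prop := fun k s' => Globals n s'.reg ∧ s'.reg 6 = k ∧
    ∃ p' o', GoodState G Y p' o' s'.mem ∧ Near G p' o' (k * n)
  -- With `2n + 2` rounds of `n` sweeps to go, the sum condition in `Near` holds trivially. The
  -- nested loops reach this number of sweeps without multiplication.
  refine (Post.loop (B := 1 + (innerTime n + 1)) Inv (fun k t h => h.2.1) ?_ (2 * n + 2) s
    ⟨hg, h6, p, o, h, .inr (by omega)⟩).mono le_rfl fun s' h => ⟨h.1, by simpa using h.2.2⟩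
  rintro k t ⟨hg, h6, p1, o1, hgood, hnear⟩
  refine Post.seq (R := fun s' => Globals n s'.reg ∧ s'.reg 6 = k + 1 ∧ s'.reg 7 = n ∧
    s'.mem = t.mem) (Post.of_wp (a := .add 7 0 5) ⟨hg.congr fun i hi => ?_, ?_, ?_, rfl⟩) ?_
  · simp [Function.update_of_ne (show i ≠ 7 by omega)]
  · simp [h6]
  · simp [hg.r0, hg.r5]
  rintro t1 ⟨hg1, e6, e7, hm1⟩
  refine (innerProg_spec hD hg1 e7 (k * n) (hm1 ▸ hgood) (by rwa [← Nat.succ_mul])).seq ?_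
  rintro t2 ⟨hr2, hgood2⟩
  have hg2 := hg1.congr fun i hi => hr2 i (by omega)
  refine Post.of_wp (a := .sub 6 6 1) ⟨hg2.congr fun i hi => ?_, ?_, hgood2⟩
  · simp [Function.update_of_ne (show i ≠ 6 by omega)]
  · simp [hr2 6 (by omega), e6, hg2.r1]

/-! ### The whole program and its polynomial time bound. -/

theorem initProg_spec {s : RamState} (h0 : s.reg 0 = n) (h : ∀ i ≠ 0, s.reg i = 0) :
    Post initProg initProg.cost s fun s' => s'.mem = s.mem ∧ s'.reg 0 = n ∧ s'.reg 1 = 1 ∧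
      s'.reg 2 = 2 * n + 2 ∧ s'.reg 3 = n + 1 ∧ s'.reg 4 = 0 ∧ s'.reg 5 = 0 ∧ s'.reg 6 = n := by
  apply Post.of_wp
  simp [initProg, wp, h0, h]
  omega

theorem squareProg_spec {s : RamState} (h0 : s.reg 0 = n) (h1 : s.reg 1 = 1)
    (h2 : s.reg 2 = 2 * n + 2) (h3 : s.reg 3 = n + 1) (h4 : s.reg 4 = 0) (h5 : s.reg 5 = 0)
    (h6 : s.reg 6 = n) :
    Post squareProg (n * (2 + 1) + 1) s fun s' => s'.mem = s.mem ∧ Globals n s'.reg := by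
  let Inv : ℕ → RamState → Prop := fun k s' => s'.mem = s.mem ∧ s'.reg 6 = k ∧
    (∀ r ≤ 5, r ≠ 4 → s'.reg r = s.reg r) ∧ s'.reg 4 + k * n = n * n
  refine (Post.loop Inv (fun k t h => h.2.1) ?_ n s ⟨rfl, h6, fun _ _ _ => rfl, by simp [h4]⟩).mono
    le_rfl ?_
  · rintro k t ⟨hm, e6, hr, e4⟩
    refine Post.of_wp (a := .seq (.add 4 4 0) (.sub 6 6 1)) ⟨hm, ?_, fun r hr5 hr4 => ?_, ?_⟩
    · simp [e6, hr 1 (by omega) (by omega), h1]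
    · simp [hr4, show r ≠ 6 by omega, hr r hr5 hr4]
    · simp [hr 0 (by omega) (by omega), h0, ← e4]; ring
  · rintro t ⟨hm, e6, hr, e4⟩
    refine ⟨hm, ?_, ?_, ?_, ?_, by simpa using e4, ?_⟩
    all_goals rw [hr _ (by omega) (by omega)]; assumption

/-- The time of the whole program. -/
def auctionTime (n : ℕ) : ℕ :=
  initProg.cost + ((n * (2 + 1) + 1) + (1 + (outerTime n + (sweepTime n + 1))))

theorem memRep_graphInput (G : SimpleGraph (Fin n)) : MemRep G 0 0 (graphInput G).mem := by
  refine ⟨fun i j => ?_, fun y => ?_, fun y => ?_⟩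
  · simp only [graphInput, ne_eq, ite_eq_right_iff, one_ne_zero, imp_false, not_not]
    refine ⟨?_, fun h => ⟨i, j, rfl, h⟩⟩
    rintro ⟨i', j', e, h⟩
    have hj : (j : ℕ) = j' := by
      have := congrArg (· % n) e
      simpa [Nat.mod_eq_of_lt] using this
    have hi : (i : ℕ) = i' :=
      Nat.eq_of_mul_eq_mul_right i.pos (by omega)
    rwa [Fin.ext hi, Fin.ext hj]
  all_goals
    simp only [graphInput, Pi.zero_apply, ite_eq_right_iff, one_ne_zero, imp_false]
    rintro ⟨i, j, e, -⟩
    have := mul_add_lt i j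
    omega

open Classical in
theorem ramOutputs_auctionProg (hD : IsDecomp G X Y) :
    RamOutputs auctionProg G (auctionTime n) X.card := by
  refine (initProg_spec (n := n) (s := graphInput G) (by simp [graphInput])
    (fun i hi => by simp [graphInput, hi])).seq ?_
  rintro s1 ⟨hm1, h0, h1, h2, h3, h4, h5, h6⟩
  refine (squareProg_spec h0 h1 h2 h3 h4 h5 h6).seq ?_
  rintro s2 ⟨hm2, hg2⟩
  refine Post.seq (R := fun s' => Globals n s'.reg ∧ s'.reg 6 = 2 * n + 2 ∧ s'.mem = s2.mem)
    (Post.of_wp (a := .add 6 2 5) ⟨hg2.congr fun i hi => ?_, ?_, rfl⟩) ?_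
  · simp [Function.update_of_ne (show i ≠ 6 by omega)]
  · simp [hg2.r2, hg2.r5]
  rintro s3 ⟨hg3, e6, hm3⟩
  refine (outerProg_spec (p := 0) (o := 0) hD hg3 e6
    ⟨?_, AuctionInv.zero, fun _ _ => Nat.zero_le _⟩).seq ?_
  · rw [hm3, hm2, hm1]; exact memRep_graphInput G
  rintro s4 ⟨hg4, p, o, hgood, hnear⟩
  -- Since all bidders are settled, the final sweep makes no bid, and its counter refers to the
  -- final prices, which single out `X`.
  have hs := hnear.settled hgood.inv
  refine (sweepProg_spec hD hg4 hgood).seq ?_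
  rintro s5 ⟨hr5, p', o', -, hpr⟩
  refine Post.of_wp (a := .add 0 10 5) ?_
  rcases hpr with ⟨h, -⟩ | ⟨-, -, -, hc⟩
  · exact absurd hs h
  simp only [wp, Function.update_self, hc, hr5 5 (by omega), hg4.r5, add_zero, highCount]
  congr 1
  ext u
  rw [Finset.mem_filter, hgood.inv.mem_iff_of_settled hD hgood.low hs u]
  exact ⟨fun h => h.2.2, fun h => ⟨Finset.mem_univ u, u.2, h⟩⟩

theorem exists_polynomial_auctionTime : ∃ q : Polynomial ℕ, ∀ n, q.eval n = auctionTime n := by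
  let x : Polynomial ℕ := Polynomial.X
  let scan : Polynomial ℕ := x * (relaxProg.cost + ownerProg.cost + 1) + 1
  let bidder : Polynomial ℕ := startProg.cost + (scan + (countProg.cost + bidProg.cost))
  let sweep : Polynomial ℕ := sweepStartProg.cost + (x * (bidder + 1) + 1)
  let inner : Polynomial ℕ := x * (sweep + 1 + 1) + 1
  let outer : Polynomial ℕ := (2 * x + 2) * (1 + (inner + 1) + 1) + 1
  refine ⟨initProg.cost + ((x * (2 + 1) + 1) + (1 + (outer + (sweep + 1)))), fun n => ?_⟩
  simp [x, scan, bidder, sweep, inner, outer, auctionTime, outerTime, innerTime, sweepTime,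
    bidderTime, scanTime]

end ConjunctiveCapacity

theorem theorem2 :
    (∀ (V : Type*) [Fintype V] (G : SimpleGraph V) (_ : ∀ v, ∃ w, G.Adj v w)
        (P : V → ℝ) (_ : ConjunctiveCapacity.IsBalanced G P),
      G.indepNum = (ConjunctiveCapacity.criticalSet G P).card +
          (ConjunctiveCapacity.restGraph G P).indepNum ∧
        ConjunctiveCapacity.HasPerfectTwoMatching (ConjunctiveCapacity.restGraph G P)) ∧
    (∃ (a : ConjunctiveCapacity.RamProg) (p : Polynomial ℕ),
      ∀ (n : ℕ) (G : SimpleGraph (Fin n)) (_ : ∀ v, ∃ w, G.Adj v w)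
        (P : Fin n → ℝ) (_ : ConjunctiveCapacity.IsBalanced G P),
      ConjunctiveCapacity.RamOutputs a G (p.eval n)
        (ConjunctiveCapacity.criticalSet G P).card) := by
  refine ⟨fun V _ G hG P hP => ?_, ?_⟩
  · let : DecidableEq V := fun _ _ => Classical.propDecidable _
    exact ⟨(hP.isDecomp hG).indepNum_eq, (hP.isDecomp hG).hasPerfectTwoMatching⟩
  · obtain ⟨q, hq⟩ := ConjunctiveCapacity.exists_polynomial_auctionTime
    refine ⟨ConjunctiveCapacity.auctionProg, q, fun n G hG P hP => ?_⟩
    rw [hq]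
    exact ConjunctiveCapacity.ramOutputs_auctionProg (hP.isDecomp hG)
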